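/- **Setting.** Let $X$ be a latent variable with law depending on $\theta\in\mathbb R^d$, let $Y=g(X;\theta)$ have density $p(\cdot\mid\theta)$, and let $Y_1,\dots,Y_T$ be observed data. Let $p(\theta)$ be a prior density, $\Lambda\subset\mathbb R^l$ a compact convex set, $\{q_\lambda\}_{\lambda\in\Lambda}$ variational densities, and $\theta(u;\lambda)\sim q_\lambda$ a re-parameterization by an outer variable $u$. Let $G_1(X,Y_t,\theta)$, $G_2(X,Y_t,\theta)$ be single-run estimators, jointly measurable in $(X,\theta)$, with $\mathbb E_X[G_1(X,Y_t,\theta)]=\nabla_\theta p(Y_t\mid\theta)$ and $\mathbb E_X[G_2(X,Y_t,\theta)]=p(Y_t\mid\theta)$ for all $\theta$ and $t$. Fix $M\ge 1$ and outer samples $u_1,\dots,u_M$; all expectations below are taken with the outer samples held fixed. Put $$A_m(\lambda)=\nabla_\lambda\theta(u_m;\lambda)\in\mathbb R^{l\times d},\quad B_m(\lambda)=\nabla_\theta\log p(\theta)\big|_{\theta=\theta(u_m;\lambda)},\quad C_m(\lambda)=\nabla_\theta\log q_\lambda(\theta)\big|_{\theta=\theta(u_m;\lambda)},$$ and define the sample-average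 gradient of the ELBO by $$\nabla\hat L_M(\lambda)=\frac1M\sum_{m=1}^M A_m(\lambda)\Big(\sum_{t=1}^T\frac{\nabla_\theta p(Y_t\mid\theta(u_m;\lambda))}{p(Y_t\mid\theta(u_m;\lambda))}+B_m(\lambda)-C_m(\lambda)\Big).$$ Let $\bar\lambda^M$ be a point of the interior of $\Lambda$ with $\nabla\hat L_M(\bar\lambda^M)=0$. **Algorithm (NMTS).** Let the inner batch size be $N\ge1$ and let $\lambda_0\in\Lambda$ and $(D_{0,m,t})$ be initial values (possibly random). For $k=0,1,\dots$ let $\theta_{k,m}=\theta(u_m;\lambda_k)$ and let $\mathcal F_k$ be the $\sigma$-algebra generated by the iterates up to time $k$. Given $\mathcal F_k$, for each $m$ draw $X_{k,m,1},\dots,X_{k,m,N}$ independently from the law of $X$ under $\theta_{k,m}$ (with any joint law over different $m$), and set $$D_{k+1,m,t}=D_{k,m,t}+\alpha_k\Big(\tfrac1N\sum_{i=1}^N G_1(X_{k,m,i},Y_t,\theta_{k,m})-\tfrac1N\sum_{i=1}^N G_2(X_{k,m,i},Y_t,\theta_{k,m})\,D_{k,m,t}\Big),$$ $$\lambda_{k+1}=\Pi_\Lambda\Big(\lambda_k+\beta_k\,\frac1M\sum_{m=1}^M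 A_m(\lambda_k)\Big(\sum_{t=1}^T D_{k,m,t}+B_m(\lambda_k)-C_m(\lambda_k)\Big)\Big),$$ where $\Pi_\Lambda$ is the Euclidean projection onto $\Lambda$. **Assumptions.** There are constants $C_1,C_2,\varepsilon>0$ and $R\ge0$, independent of $N$, such that almost surely, for all $k,m,t$, $$\mathbb E_X\Big[\sum_s\|G_1(X,Y_s,\theta_{k,m})\|^2\Big]\le C_1,\quad \mathbb E_X\Big[\sum_s|G_2(X,Y_s,\theta_{k,m})|^2\Big]\le C_2,\quad \mathbb E_X[G_2(X,Y_t,\theta_{k,m})]\ge\varepsilon,$$ where $\mathbb E_X$ is over $X$ drawn under $\theta_{k,m}$ with $\theta_{k,m}$ held fixed, and $\mathbb E\sum_{m,t}\|D_{0,m,t}\|^2\le R$. Each $p(Y_t\mid\cdot)$ is positive and $C^2$ on $\mathbb R^d$; each $\theta(u_m;\cdot)$ is $C^2$ on $\Lambda$; $p(\cdot)$ and $q_\lambda$ are positive and differentiable at $\theta(u_m;\lambda)$ for $\lambda\in\Lambda$; and $A_m,B_m,C_m$ are $C^1$ on $\Lambda$. There is $K_L>0$ such that $v^\top H_M(\lambda)v\le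 -K_L\|v\|^2$ for all $\lambda\in\Lambda$ and $v\in\mathbb R^l$, where $H_M$ is the derivative of $\nabla\hat L_M$. The step sizes are positive with $\alpha_k=\alpha_0k^{-a}$ and $\beta_k=\beta_0k^{-b}$ for $k\ge1$, where $\alpha_0,\beta_0>0$ and $\tfrac12<a<b\le1$. If $b=1$, then moreover $\beta_0K_L>\max(1-a,\tfrac a2)$. **Conclusion.** There are constants $c_1,c_2\ge0$, independent of $N$ and $k$, such that for every $N\ge1$ and every $k\ge1$ $$\mathbb E\|\lambda_k-\bar\lambda^M\|\le c_1\frac{\beta_k}{\alpha_k}+c_2\sqrt{\frac{\alpha_k}{N}}.$$ In particular, for every fixed $N\ge 1$ one has $\mathbb E\|\lambda_k-\bar\lambda^M\|\to0$ as $k\to\infty$ (there is no asymptotic $O(N^{-1/2})$ bias), and for $a=\tfrac23$, $b=1$ there is a constant $c$, independent of $N$ and $k$, with $\mathbb E\|\lambda_k-\bar\lambda^M\|\le c\,k^{-1/3}$ for all $N\ge1$ and $k\ge1$. -/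

import Mathlib

open MeasureTheory ProbabilityTheory Filter Topology

universe u₁ u₂ u₃ w

noncomputable section

/-- Real `n`-space with the Euclidean norm. -/
abbrev Vec (n : ℕ) : Type := EuclideanSpace ℝ (Fin n)

/-- A likelihood-free posterior density estimation problem.
`d` is the dimension of the model parameter `θ`, `l` that of the variational parameter `λ`, and
`T` is the number of observations. -/
structure PosteriorProblem (𝒳 : Type u₁) (𝒴 : Type u₂) (𝒰 : Type u₃)
    [MeasurableSpace 𝒳] [MeasurableSpace 𝒴] [MeasurableSpace 𝒰] (d l T : ℕ) where
  /-- the law of the latent variable `X` under the parameter `θ` -/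
  latent : Kernel (Vec d) 𝒳
  latent_prob : IsMarkovKernel latent
  /-- the observable variable is `Y = g(X; θ)` -/
  g : 𝒳 → Vec d → 𝒴
  g_meas : ∀ θ, Measurable fun x => g x θ
  /-- the reference measure for densities of `Y` -/
  ref : Measure 𝒴
  /-- `lik y θ = p(y | θ)`, the density of `Y` under `θ` -/
  lik : 𝒴 → Vec d → ℝ
  lik_nonneg : ∀ y θ, 0 ≤ lik y θ
  lik_meas : ∀ θ, Measurable fun y => lik y θ
  lik_density : ∀ θ, (latent θ).map (fun x => g x θ) =
    ref.withDensity fun y => ENNReal.ofReal (lik y θ)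
  /-- the observed data `Y_1, …, Y_T` -/
  obs : Fin T → 𝒴
  /-- the prior density of `θ` -/
  prior : Vec d → ℝ
  prior_nonneg : ∀ θ, 0 ≤ prior θ
  prior_meas : Measurable prior
  prior_density : ∫⁻ θ, ENNReal.ofReal (prior θ) = 1
  /-- the feasible region `Λ` of the variational parameter -/
  feasible : Set (Vec l)
  /-- the law of the outer variable `u` -/
  outer : Measure 𝒰
  outer_prob : IsProbabilityMeasure outer
  /-- the re-parameterization `θ(u; λ)` -/
  reparam : 𝒰 → Vec l → Vec d
  reparam_meas : ∀ lam ∈ feasible, Measurable fun v => reparam v lam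
  /-- `q lam` is the variational density `q_λ`; it is the density of `θ(u; λ)` -/
  q : Vec l → Vec d → ℝ
  q_nonneg : ∀ lam ∈ feasible, ∀ θ, 0 ≤ q lam θ
  q_meas : ∀ lam ∈ feasible, Measurable (q lam)
  q_density : ∀ lam ∈ feasible, outer.map (fun v => reparam v lam) =
    volume.withDensity fun θ => ENNReal.ofReal (q lam θ)
  /-- `G1 x y θ` is the single-run estimator of `∇_θ p(y | θ)` -/
  G1 : 𝒳 → 𝒴 → Vec d → Vec d
  /-- `G2 x y θ` is the single-run estimator of `p(y | θ)` -/
  G2 : 𝒳 → 𝒴 → Vec d → ℝ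
  G1_meas : ∀ t, Measurable fun z : 𝒳 × Vec d => G1 z.1 (obs t) z.2
  G2_meas : ∀ t, Measurable fun z : 𝒳 × Vec d => G2 z.1 (obs t) z.2

variable {𝒳 : Type u₁} {𝒴 : Type u₂} {𝒰 : Type u₃}
  [MeasurableSpace 𝒳] [MeasurableSpace 𝒴] [MeasurableSpace 𝒰] {d l T M N : ℕ}

namespace PosteriorProblem

/-- `∇_λ θ(u; λ)`, the `l × d` matrix which is the transpose of the derivative of
`θ(u; ·)` on the feasible region. -/
def jac (P : PosteriorProblem 𝒳 𝒴 𝒰 d l T) (v : 𝒰) (lam : Vec l) : Vec d →L[ℝ] Vec l :=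
  ContinuousLinearMap.adjoint (fderivWithin ℝ (P.reparam v) P.feasible lam)

/-- `∇_θ log p(θ)` at `θ = θ(u; λ)`. -/
def priorScore (P : PosteriorProblem 𝒳 𝒴 𝒰 d l T) (v : 𝒰) (lam : Vec l) : Vec d :=
  gradient (fun θ => Real.log (P.prior θ)) (P.reparam v lam)

/-- `∇_θ log q_λ(θ)` at `θ = θ(u; λ)`. -/
def varScore (P : PosteriorProblem 𝒳 𝒴 𝒰 d l T) (v : 𝒰) (lam : Vec l) : Vec d :=
  gradient (fun θ => Real.log (P.q lam θ)) (P.reparam v lam)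

/-- The slow-timescale direction at `λ`, given the gradient trackers `Dk m t` of the
outer samples `u m` and the observations `t`. -/
def slowDir (P : PosteriorProblem 𝒳 𝒴 𝒰 d l T) (u : Fin M → 𝒰)
    (Dk : Fin M → Fin T → Vec d) (lam : Vec l) : Vec l :=
  (M : ℝ)⁻¹ • ∑ m, P.jac (u m) lam
    ((∑ t, Dk m t) + P.priorScore (u m) lam - P.varScore (u m) lam)

/-- The sample-average gradient of the ELBO at `λ` for the outer samples `u`: each tracker
is replaced by its target `∇_θ p(Y_t | θ) / p(Y_t | θ)` at `θ = θ(u_m; λ)`. -/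
def saaGrad (P : PosteriorProblem 𝒳 𝒴 𝒰 d l T) (u : Fin M → 𝒰) (lam : Vec l) : Vec l :=
  P.slowDir u (fun m t => (P.lik (P.obs t) (P.reparam (u m) lam))⁻¹ •
    gradient (P.lik (P.obs t)) (P.reparam (u m) lam)) lam

/-- The regularity assumptions, at the outer samples `u`. -/
structure Regular (P : PosteriorProblem 𝒳 𝒴 𝒰 d l T) (u : Fin M → 𝒰) : Prop where
  compact : IsCompact P.feasible
  convex : Convex ℝ P.feasible
  lik_pos : ∀ t θ, 0 < P.lik (P.obs t) θ
  lik_smooth : ∀ t, ContDiff ℝ 2 (P.lik (P.obs t))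
  reparam_smooth : ∀ m, ContDiffOn ℝ 2 (P.reparam (u m)) P.feasible
  prior_pos : ∀ m, ∀ lam ∈ P.feasible, 0 < P.prior (P.reparam (u m) lam)
  prior_diff : ∀ m, ∀ lam ∈ P.feasible, DifferentiableAt ℝ P.prior (P.reparam (u m) lam)
  priorScore_smooth : ∀ m, ContDiffOn ℝ 1 (P.priorScore (u m)) P.feasible
  q_pos : ∀ m, ∀ lam ∈ P.feasible, 0 < P.q lam (P.reparam (u m) lam)
  q_diff : ∀ m, ∀ lam ∈ P.feasible, DifferentiableAt ℝ (P.q lam) (P.reparam (u m) lam)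
  varScore_smooth : ∀ m, ContDiffOn ℝ 1 (P.varScore (u m)) P.feasible

/-- The single-run estimators are unbiased. -/
structure Unbiased (P : PosteriorProblem 𝒳 𝒴 𝒰 d l T) : Prop where
  int1 : ∀ t θ, Integrable (fun x => P.G1 x (P.obs t) θ) (P.latent θ)
  mean1 : ∀ t θ, ∫ x, P.G1 x (P.obs t) θ ∂(P.latent θ) = gradient (P.lik (P.obs t)) θ
  int2 : ∀ t θ, Integrable (fun x => P.G2 x (P.obs t) θ) (P.latent θ)
  mean2 : ∀ t θ, ∫ x, P.G2 x (P.obs t) θ ∂(P.latent θ) = P.lik (P.obs t) θ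

end PosteriorProblem

/-- The `σ`-algebra generated by the iterates up to time `k`. -/
abbrev history {Ω : Type w} (D : ℕ → Fin M → Fin T → Ω → Vec d) (lam : ℕ → Ω → Vec l) (k : ℕ) :
    MeasurableSpace Ω :=
  ⨆ j ∈ Set.Iic k, (MeasurableSpace.comap (lam j) inferInstance ⊔
    ⨆ m, ⨆ t, MeasurableSpace.comap (D j m t) inferInstance)

/-- `y` is a point of `Λ` nearest to `x` (for compact convex `Λ` there is only one). -/
def IsNearest (Λ : Set (Vec l)) (x y : Vec l) : Prop :=
  y ∈ Λ ∧ ∀ z ∈ Λ, dist x y ≤ dist x z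

/-- A run of the nested multi-time-scale algorithm with outer samples `u`, step sizes `α`
(fast) and `β` (slow) and inner batch size `N`. `X k m i` is the `i`-th inner sample of block
`m` at iteration `k`, `D k m t` is the part of the fast iterate that belongs to the outer
sample `m` and the observation `t`, and `lam k` is the slow iterate. Blocks may share their
inner samples: nothing is said on the joint law over `m`. -/
structure IsNMTSRun (P : PosteriorProblem 𝒳 𝒴 𝒰 d l T) (u : Fin M → 𝒰) (α β : ℕ → ℝ)
    {Ω : Type w} [MeasurableSpace Ω] (μ : Measure Ω) (X : ℕ → Fin M → Fin N → Ω → 𝒳)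
    (D : ℕ → Fin M → Fin T → Ω → Vec d) (lam : ℕ → Ω → Vec l) : Prop where
  X_meas : ∀ k m i, Measurable (X k m i)
  D_meas : ∀ k m t, Measurable (D k m t)
  lam_meas : ∀ k, Measurable (lam k)
  init : ∀ ω, lam 0 ω ∈ P.feasible
  /-- given the past, `X k m 1, …, X k m N` are independent draws from the law of the latent
  variable under `θ(u_m; λ_k)` -/
  sampling : ∀ (k : ℕ) (m : Fin M) (S : Set Ω), MeasurableSet[history D lam k] S →
    ∀ B : Fin N → Set 𝒳, (∀ i, MeasurableSet (B i)) →
      μ (S ∩ ⋂ i, X k m i ⁻¹' B i) =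
        ∫⁻ ω in S, ∏ i, P.latent (P.reparam (u m) (lam k ω)) (B i) ∂μ
  fast : ∀ k m t ω, D (k + 1) m t ω = D k m t ω + α k •
    (((N : ℝ)⁻¹ • ∑ i, P.G1 (X k m i ω) (P.obs t) (P.reparam (u m) (lam k ω))) -
      ((N : ℝ)⁻¹ * ∑ i, P.G2 (X k m i ω) (P.obs t) (P.reparam (u m) (lam k ω))) • D k m t ω)
  slow : ∀ k ω, IsNearest P.feasible
    (lam k ω + β k • P.slowDir u (fun m t => D k m t ω) (lam k ω)) (lam (k + 1) ω)

/-- The moment assumptions along a run. Given the past, a single inner sample has the law of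
the latent variable under `θ(u_m; λ_k)`, so the integrals are conditional expectations given
the past. The last field bounds the second moment of the initial trackers. -/
structure MomentBounds (P : PosteriorProblem 𝒳 𝒴 𝒰 d l T) (u : Fin M → 𝒰)
    (C₁ C₂ ε R : ℝ) {Ω : Type w} [MeasurableSpace Ω] (μ : Measure Ω)
    (D : ℕ → Fin M → Fin T → Ω → Vec d) (lam : ℕ → Ω → Vec l) : Prop where
  second1 : ∀ k m, ∀ᵐ ω ∂μ,
    ∫⁻ x, ∑ t, ‖P.G1 x (P.obs t) (P.reparam (u m) (lam k ω))‖ₑ ^ 2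
      ∂(P.latent (P.reparam (u m) (lam k ω))) ≤ ENNReal.ofReal C₁
  second2 : ∀ k m, ∀ᵐ ω ∂μ,
    ∫⁻ x, ∑ t, ‖P.G2 x (P.obs t) (P.reparam (u m) (lam k ω))‖ₑ ^ 2
      ∂(P.latent (P.reparam (u m) (lam k ω))) ≤ ENNReal.ofReal C₂
  lower : ∀ k m t, ∀ᵐ ω ∂μ,
    ε ≤ ∫ x, P.G2 x (P.obs t) (P.reparam (u m) (lam k ω))
      ∂(P.latent (P.reparam (u m) (lam k ω)))
  initial : ∫⁻ ω, ∑ m, ∑ t, ‖D 0 m t ω‖ₑ ^ 2 ∂μ ≤ ENNReal.ofReal R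

end

/-! The trackers and the slow iterate each obey a scalar inequality, and the theorem solves the two
in turn.

Let `e` be a tracker error, `D` minus its target `∇p/p` at the current `λ`. Since `p · (∇p/p) = ∇p`,
a fast step with the target frozen sends `e` to `(1 - α p) e` plus `α` times an average of `N`
centred, conditionally independent vectors. Orthogonality (`CondSample.secondMoment`) makes the
squares add and leaves `α² / N` times a second moment that grows at most linearly in the mean square
error. The likelihood is bounded below on the compact set of parameters in use, so the first part
contracts. The target then moves by `O(β (1 + ∑ ‖e‖))`, because it is Lipschitz in `λ` and the
projection is nonexpansive. Young's inequality with weight of order `α` gives, for the total mean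
square error `V`, a contraction `1 - cα` with forcing `α²/N + β²/α`, hence `V = O(α/N + (β/α)²)`
(`trackMSE_succ_le`, `exists_fast_rate`).

For the slow iterate, strong monotonicity of the sample-average gradient makes an exact gradient
step contract by `1 - K_L β + O(β²)`. Replacing the gradient by the trackers costs at most `O(β √V)`
in mean, with no cancellation needed. Solving this recursion gives `O(β/α + √(α/N))`
(`integral_norm_sub_succ_le`, `exists_slow_rate`).

Both recursions are solved by one comparison lemma, applied to the whole family of admissible
sequences at once; this is what keeps the constants free of `N` and of the run. When `b = 1` the
slow contraction is only `1 - β₀ K_L / k`, which must beat the decay exponents `1 - a` and `a/2` of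
the two error terms. -/

noncomputable section

/-! ### Conditionally independent samples and their second moments -/

section ConditionalSampling

variable {Ω E 𝒳 V : Type*} [MeasurableSpace Ω] [MeasurableSpace E] [MeasurableSpace 𝒳]
  [NormedAddCommGroup V] [InnerProductSpace ℝ V]
  {μ : Measure Ω} [IsProbabilityMeasure μ] {N : ℕ} {Z : Ω → E} {X : Fin N → Ω → 𝒳}
  {κ : Kernel E 𝒳} [IsMarkovKernel κ]

/-- Given `Z`, the `X i` are independent draws from `κ`. -/
def CondSample (μ : Measure Ω) (Z : Ω → E) (X : Fin N → Ω → 𝒳) (κ : Kernel E 𝒳) : Prop :=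
  ∀ A : Set E, MeasurableSet A → ∀ B : Fin N → Set 𝒳, (∀ i, MeasurableSet (B i)) →
    μ (Z ⁻¹' A ∩ ⋂ i, X i ⁻¹' B i) = ∫⁻ ω in Z ⁻¹' A, ∏ i, κ (Z ω) (B i) ∂μ

/-- Rectangles determine a finite measure on a product; the sampling identity is used with the whole
space in every coordinate but `i`. -/
theorem CondSample.map_one (h : CondSample μ Z X κ) (hZ : Measurable Z)
    (hX : ∀ i, Measurable (X i)) (i : Fin N) :
    μ.map (fun ω => (Z ω, X i ω)) = (μ.map Z) ⊗ₘ κ := by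
  have := Measure.isProbabilityMeasure_map (μ := μ) (hZ.prodMk (hX i)).aemeasurable
  have := Measure.isProbabilityMeasure_map (μ := μ) hZ.aemeasurable
  refine Measure.ext_prod fun {s t} hs ht => ?_
  classical
  rw [Measure.map_apply (hZ.prodMk (hX i)) (hs.prod ht), Measure.compProd_apply_prod hs ht,
    setLIntegral_map hs (κ.measurable_coe ht) hZ]
  have := h s hs (fun j => if j = i then t else Set.univ)
    (fun j => by split_ifs <;> simp [ht])
  convert this using 2
  · ext ω
    simp only [Set.mem_preimage, Set.mem_prod, Set.mem_inter_iff, Set.mem_iInter]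
    refine and_congr_right fun _ => ⟨fun hx j => ?_, fun hx => by simpa using hx i⟩
    by_cases hj : j = i <;> simp [hj, hx]
  · ext ω
    rw [Finset.prod_eq_single i] <;> simp +contextual

/-- Conditional independence takes the form that, once `Z` is known, the kernel producing `X j`
ignores `X i`. This lets `X i` join the conditioning state when a cross term is computed. -/
theorem CondSample.map_two (h : CondSample μ Z X κ) (hZ : Measurable Z)
    (hX : ∀ i, Measurable (X i)) {i j : Fin N} (hij : i ≠ j) :
    μ.map (fun ω => ((Z ω, X i ω), X j ω)) =
      (μ.map (fun ω => (Z ω, X i ω))) ⊗ₘ (Kernel.prodMkRight 𝒳 κ) := by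
  have := Measure.isProbabilityMeasure_map (μ := μ)
    ((hZ.prodMk (hX i)).prodMk (hX j)).aemeasurable
  have := Measure.isProbabilityMeasure_map (μ := μ) hZ.aemeasurable
  rw [h.map_one hZ hX i]
  refine Measure.ext_prod₃' fun {s t v} hs ht hv => ?_
  classical
  rw [Measure.map_apply ((hZ.prodMk (hX i)).prodMk (hX j)) ((hs.prod ht).prod hv),
    Measure.compProd_apply_prod (hs.prod ht) hv,
    Measure.setLIntegral_compProd (Kernel.measurable_coe _ hv) hs ht]
  simp only [Kernel.prodMkRight_apply, lintegral_const, MeasurableSet.univ,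
    Measure.restrict_apply, Set.univ_inter]
  rw [setLIntegral_map (f := fun a => κ a v * κ a t) hs
    ((κ.measurable_coe hv).mul (κ.measurable_coe ht)) hZ]
  have := h s hs (fun k => if k = i then t else if k = j then v else Set.univ)
    (fun k => by split_ifs <;> simp [ht, hv])
  convert this using 2
  · ext ω
    simp only [Set.mem_preimage, Set.mem_prod, Set.mem_inter_iff, Set.mem_iInter, and_assoc]
    refine and_congr_right fun _ => ⟨fun hx k => ?_, fun hx => ⟨by simpa using hx i,
      by simpa [hij.symm] using hx j⟩⟩
    by_cases hk : k = i
    · simp [hk, hx]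
    · by_cases hk' : k = j <;> simp [hk, hk', hx, hij.symm]
  · ext ω
    rw [← Finset.prod_subset (Finset.subset_univ {i, j}), Finset.prod_pair hij]
    · simp [hij.symm, mul_comm]
    · intro k _ hk
      simp only [Finset.mem_insert, Finset.mem_singleton, not_or] at hk
      simp [hk.1, hk.2]

/-- After disintegration the inner integral is the product of `F` with the mean of `H`, which is
zero. -/
theorem integral_inner_of_centered [CompleteSpace V] {W : Ω → E} {Y : Ω → 𝒳} (hW : Measurable W)
    (hY : Measurable Y) (hlaw : μ.map (fun ω => (W ω, Y ω)) = (μ.map W) ⊗ₘ κ)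
    {F : E → V} {H : E × 𝒳 → V} (hF : StronglyMeasurable F) (hH : StronglyMeasurable H)
    (hint : ∀ z, Integrable (fun x => H (z, x)) (κ z)) (hmean : ∀ z, ∫ x, H (z, x) ∂κ z = 0)
    (hi : Integrable (fun ω => inner ℝ (F (W ω)) (H (W ω, Y ω))) μ) :
    ∫ ω, inner ℝ (F (W ω)) (H (W ω, Y ω)) ∂μ = 0 := by
  have := Measure.isProbabilityMeasure_map (μ := μ) hW.aemeasurable
  have hm : StronglyMeasurable fun p : E × 𝒳 => inner ℝ (F p.1) (H p) :=
    (hF.comp_measurable measurable_fst).inner hH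
  have e : ∫ ω, inner ℝ (F (W ω)) (H (W ω, Y ω)) ∂μ =
      ∫ p, inner ℝ (F p.1) (H p) ∂(μ.map (fun ω => (W ω, Y ω))) := by
    rw [integral_map (hW.prodMk hY).aemeasurable hm.aestronglyMeasurable]
  have hi' : Integrable (fun p : E × 𝒳 => inner ℝ (F p.1) (H p))
      (μ.map (fun ω => (W ω, Y ω))) :=
    (integrable_map_measure hm.aestronglyMeasurable (hW.prodMk hY).aemeasurable).2 hi
  rw [e, hlaw] at *
  rw [Measure.integral_compProd hi']
  simp [integral_inner (hint _), hmean]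

theorem integrable_inner_of_memLp_two {ν : Measure Ω} {f g : Ω → V} (hf : MemLp f 2 ν)
    (hg : MemLp g 2 ν) : Integrable (fun ω => inner ℝ (f ω) (g ω)) ν := by
  refine ((hf.integrable_norm_pow (by simp)).add (hg.integrable_norm_pow (by simp))).mono'
    (hf.1.inner hg.1) (ae_of_all _ fun ω => ?_)
  simp only [Pi.add_apply]
  nlinarith [norm_inner_le_norm (𝕜 := ℝ) (f ω) (g ω), sq_nonneg (‖f ω‖ - ‖g ω‖),
    sq_nonneg (‖f ω‖), sq_nonneg (‖g ω‖)]

/-- The second moment of a state-dependent vector plus the average of `N` conditionally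
independent centred vectors. -/
theorem CondSample.secondMoment [CompleteSpace V] [SecondCountableTopology V]
    [MeasurableSpace V] [BorelSpace V] (h : CondSample μ Z X κ) (hZ : Measurable Z)
    (hX : ∀ i, Measurable (X i)) (hN : 1 ≤ N) {F : E → V} {H : E × 𝒳 → V} (hF : Measurable F)
    (hH : Measurable H) (hint : ∀ z, Integrable (fun x => H (z, x)) (κ z))
    (hmean : ∀ z, ∫ x, H (z, x) ∂κ z = 0) (hF2 : MemLp (fun ω => F (Z ω)) 2 μ)
    {v : ℝ} (hv : 0 ≤ v)
    (hH2 : ∫⁻ ω, ∫⁻ x, ‖H (Z ω, x)‖ₑ ^ 2 ∂κ (Z ω) ∂μ ≤ ENNReal.ofReal v) (c : ℝ) :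
    MemLp (fun ω => F (Z ω) + c • ((N : ℝ)⁻¹ • ∑ i, H (Z ω, X i ω))) 2 μ ∧
    ∫ ω, ‖F (Z ω) + c • ((N : ℝ)⁻¹ • ∑ i, H (Z ω, X i ω))‖ ^ 2 ∂μ ≤
      ∫ ω, ‖F (Z ω)‖ ^ 2 ∂μ + c ^ 2 * v / N := by
  have hp := Measure.isProbabilityMeasure_map (μ := μ) hZ.aemeasurable
  have hNpos : (0 : ℝ) < N := by exact_mod_cast hN
  have hmeas : ∀ i, Measurable fun ω => H (Z ω, X i ω) := fun i => hH.comp (hZ.prodMk (hX i))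
  have hlin : ∀ i, ∫⁻ ω, ‖H (Z ω, X i ω)‖ₑ ^ 2 ∂μ ≤ ENNReal.ofReal v := fun i => by
    have hm : Measurable fun p : E × 𝒳 => ‖H p‖ₑ ^ 2 := hH.enorm.pow_const 2
    have e1 : ∫⁻ ω, ‖H (Z ω, X i ω)‖ₑ ^ 2 ∂μ =
        ∫⁻ p, ‖H p‖ₑ ^ 2 ∂(μ.map fun ω => (Z ω, X i ω)) := by
      rw [lintegral_map hm (hZ.prodMk (hX i))]
    rw [e1, h.map_one hZ hX i, Measure.lintegral_compProd hm,
      lintegral_map hm.lintegral_kernel_prod_right' hZ]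
    exact hH2
  have hL2 : ∀ i, MemLp (fun ω => H (Z ω, X i ω)) 2 μ := fun i => by
    refine ⟨(hmeas i).aestronglyMeasurable, ?_⟩
    rw [eLpNorm_lt_top_iff_lintegral_rpow_enorm_lt_top (by simp) (by simp)]
    simpa using (hlin i).trans_lt ENNReal.ofReal_lt_top
  have hsq : ∀ i, ∫ ω, ‖H (Z ω, X i ω)‖ ^ 2 ∂μ ≤ v := fun i => by
    rw [integral_eq_lintegral_of_nonneg_ae (ae_of_all _ fun ω => by positivity)
      ((hmeas i).norm.pow_const 2).aestronglyMeasurable]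
    refine ENNReal.toReal_le_of_le_ofReal hv ((hlin i).trans' (lintegral_mono fun ω => ?_))
    rw [← ofReal_norm, ENNReal.ofReal_pow (norm_nonneg _)]
  -- The state is enlarged to `(Z, X i)`; given it, the `j`-th term is still centred.
  have hcross : ∀ i j, i ≠ j → ∫ ω, inner ℝ (H (Z ω, X i ω)) (H (Z ω, X j ω)) ∂μ = 0 :=
    fun i j hij => integral_inner_of_centered (κ := Kernel.prodMkRight 𝒳 κ)
      (W := fun ω => (Z ω, X i ω)) (Y := X j) (F := H) (H := fun p => H (p.1.1, p.2))
      (hZ.prodMk (hX i)) (hX j) (h.map_two hZ hX hij) hH.stronglyMeasurable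
      (hH.comp (by fun_prop)).stronglyMeasurable (fun z => by simpa using hint z.1)
      (fun z => by simpa using hmean z.1) (integrable_inner_of_memLp_two (hL2 i) (hL2 j))
  have hcrossF : ∀ i, ∫ ω, inner ℝ (F (Z ω)) (H (Z ω, X i ω)) ∂μ = 0 := fun i =>
    integral_inner_of_centered hZ (hX i) (h.map_one hZ hX i) hF.stronglyMeasurable
      hH.stronglyMeasurable hint hmean (integrable_inner_of_memLp_two hF2 (hL2 i))
  have hS : MemLp (fun ω => ∑ i, H (Z ω, X i ω)) 2 μ := memLp_finsetSum _ fun i _ => hL2 i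
  -- Only the `N` diagonal terms survive, so the sum has second moment `N v` rather than `N² v`.
  -- This is the source of the factor `1 / N`.
  have hS2 : ∫ ω, ‖∑ i, H (Z ω, X i ω)‖ ^ 2 ∂μ ≤ N * v := by
    have e : ∀ ω, ‖∑ i, H (Z ω, X i ω)‖ ^ 2 =
        ∑ i, ∑ j, inner ℝ (H (Z ω, X i ω)) (H (Z ω, X j ω)) := fun ω => by
      rw [← real_inner_self_eq_norm_sq, sum_inner]
      simp_rw [inner_sum]
    simp_rw [e]
    rw [integral_finsetSum _ fun i _ => integrable_finsetSum _ fun j _ =>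
      integrable_inner_of_memLp_two (hL2 i) (hL2 j)]
    have : ∀ i, ∫ ω, ∑ j, inner ℝ (H (Z ω, X i ω)) (H (Z ω, X j ω)) ∂μ ≤ v := fun i => by
      rw [integral_finsetSum _ fun j _ => integrable_inner_of_memLp_two (hL2 i) (hL2 j),
        Finset.sum_eq_single i (fun j _ hj => hcross i j hj.symm) (by simp)]
      simpa only [real_inner_self_eq_norm_sq] using hsq i
    calc _ ≤ ∑ _i : Fin N, v := Finset.sum_le_sum fun i _ => this i
      _ = _ := by simp
  have hFS : ∫ ω, inner ℝ (F (Z ω)) (∑ i, H (Z ω, X i ω)) ∂μ = 0 := by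
    simp_rw [inner_sum]
    rw [integral_finsetSum _ fun i _ => integrable_inner_of_memLp_two hF2 (hL2 i)]
    simp [hcrossF]
  refine ⟨hF2.add ((hS.const_smul _).const_smul _), ?_⟩
  have e : ∀ ω, ‖F (Z ω) + c • ((N : ℝ)⁻¹ • ∑ i, H (Z ω, X i ω))‖ ^ 2 = ‖F (Z ω)‖ ^ 2 +
      2 * (c * (N : ℝ)⁻¹) * inner ℝ (F (Z ω)) (∑ i, H (Z ω, X i ω)) +
      (c * (N : ℝ)⁻¹) ^ 2 * ‖∑ i, H (Z ω, X i ω)‖ ^ 2 := fun ω => by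
    rw [smul_smul, norm_add_sq_real, inner_smul_right, norm_smul, mul_pow, Real.norm_eq_abs,
      sq_abs]
    ring
  simp_rw [e]
  rw [integral_add, integral_add, integral_const_mul, integral_const_mul, hFS]
  · have : (c * (N : ℝ)⁻¹) ^ 2 * ∫ ω, ‖∑ i, H (Z ω, X i ω)‖ ^ 2 ∂μ ≤
        (c * (N : ℝ)⁻¹) ^ 2 * (N * v) := by gcongr
    have e2 : (c * (N : ℝ)⁻¹) ^ 2 * (N * v) = c ^ 2 * v / N := by field_simp
    linarith
  · exact hF2.integrable_norm_pow (by simp)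
  · exact (integrable_inner_of_memLp_two hF2 hS).const_mul _
  · exact (hF2.integrable_norm_pow (by simp)).add
      ((integrable_inner_of_memLp_two hF2 hS).const_mul _)
  · exact (hS.integrable_norm_pow (by simp)).const_mul _

end ConditionalSampling

/-! ### Scalar recursions with vanishing step sizes -/

section ScalarRecursions

/-- A Chung-type comparison: a recursion with contraction factor `1 - γ k` is dominated by `s`
when `s` decays at a slower rate. The constant is uniform over the family. -/
theorem exists_uniform_const_of_contraction {ι : Type*} {w s : ι → ℕ → ℝ} {σ τ γ : ℕ → ℝ}
    {δ c : ℝ} (hδ : 0 < δ) (hσ : ∀ k, 1 ≤ k → 0 < σ k) (hs : ∀ i k, 1 ≤ k → σ k ≤ s i k)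
    (hB : ∀ k, 1 ≤ k → ∃ B, ∀ i, w i k ≤ B)
    (hτ : ∀ᶠ k in atTop, 0 ≤ τ k) (hγ : ∀ᶠ k in atTop, γ k ≤ 1)
    (hrec : ∀ᶠ k in atTop, ∀ i, w i (k + 1) ≤ (1 - γ k) * w i k + c * τ k * s i k)
    (hdecay : ∀ᶠ k in atTop, ∀ i, (1 - γ k + δ * τ k) * s i k ≤ s i (k + 1)) :
    ∃ C, 0 ≤ C ∧ ∀ i k, 1 ≤ k → w i k ≤ C * s i k := by
  obtain ⟨k₀, hk₀⟩ := eventually_atTop.1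
    (hτ.and (hγ.and (hrec.and (hdecay.and (eventually_ge_atTop 1)))))
  choose! B hB using hB
  -- The term `|c| / δ` lets the slack `δ τ` in the decay of `s` pay for the forcing in the
  -- induction. The finite sum covers the indices up to `k₀`, where `σ` is a positive floor common
  -- to all `s i`.
  set C := |c| / δ + ∑ k ∈ Finset.Icc 1 k₀, |B k| / σ k with hC
  have hnn : ∀ k ∈ Finset.Icc 1 k₀, 0 ≤ |B k| / σ k := fun k hk =>
    div_nonneg (abs_nonneg _) (hσ k (Finset.mem_Icc.1 hk).1).le
  have hC0 : 0 ≤ C := add_nonneg (by positivity) (Finset.sum_nonneg hnn)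
  have hcC : c ≤ C * δ := by
    have : |c| / δ ≤ C := le_add_of_nonneg_right (Finset.sum_nonneg hnn)
    rw [div_le_iff₀ hδ] at this
    exact (le_abs_self c).trans this
  have hspos : ∀ i k, 1 ≤ k → 0 < s i k := fun i k hk => (hσ k hk).trans_le (hs i k hk)
  have hsmall : ∀ i k, 1 ≤ k → k ≤ k₀ → w i k ≤ C * s i k := fun i k hk hkk => by
    have h1 : |B k| / σ k ≤ C := (Finset.single_le_sum hnn
      (Finset.mem_Icc.2 ⟨hk, hkk⟩)).trans (le_add_of_nonneg_left (by positivity))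
    calc w i k ≤ |B k| := (hB k hk i).trans (le_abs_self _)
      _ = |B k| / σ k * σ k := (div_mul_cancel₀ _ (hσ k hk).ne').symm
      _ ≤ C * s i k := mul_le_mul h1 (hs i k hk) (hσ k hk).le hC0
  refine ⟨C, hC0, fun i k hk => ?_⟩
  rcases le_total k k₀ with hkk | hkk
  · exact hsmall i k hk hkk
  · induction k, hkk using Nat.le_induction with
    | base => exact hsmall i k₀ hk le_rfl
    | succ k hkk ih =>
      obtain ⟨h1, h2, h3, h4, h5⟩ := hk₀ k hkk
      have hsk := hspos i k h5
      calc w i (k + 1) ≤ (1 - γ k) * w i k + c * τ k * s i k := h3 i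
        _ ≤ (1 - γ k) * (C * s i k) + C * δ * τ k * s i k := by
          have := mul_le_mul_of_nonneg_left (ih h5) (sub_nonneg.2 h2)
          have := mul_le_mul_of_nonneg_right hcC (mul_nonneg h1 hsk.le)
          nlinarith
        _ = C * ((1 - γ k + δ * τ k) * s i k) := by ring
        _ ≤ C * s i (k + 1) := mul_le_mul_of_nonneg_left (h4 i) hC0

/-- The ratio of the two powers is `exp (-p log (1 + 1/k))`, and `exp x ≥ 1 + x` and `log (1 + x) ≤
x` finish. A power therefore loses at most the fraction `p / k` per step, to be compared with the
contraction. -/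
theorem one_sub_mul_rpow_neg_le {p : ℝ} (hp : 0 ≤ p) {k : ℕ} (hk : 1 ≤ k) :
    (1 - p / k) * (k : ℝ) ^ (-p) ≤ ((k + 1 : ℕ) : ℝ) ^ (-p) := by
  have hk0 : (0 : ℝ) < k := by exact_mod_cast hk
  have e : ((k + 1 : ℕ) : ℝ) = (1 + 1 / k) * k := by push_cast; field_simp
  have h1 : (0 : ℝ) < 1 + 1 / k := by positivity
  rw [e, Real.mul_rpow h1.le hk0.le]
  refine mul_le_mul_of_nonneg_right ?_ (by positivity)
  rw [Real.rpow_def_of_pos h1]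
  have h2 := Real.log_le_sub_one_of_pos h1
  have h3 := Real.add_one_le_exp (Real.log (1 + 1 / k) * -p)
  have h4 : Real.log (1 + 1 / (k : ℝ)) * p ≤ 1 / k * p :=
    mul_le_mul_of_nonneg_right (by linarith) hp
  have h5 : p / k = 1 / (k : ℝ) * p := by ring
  linarith

/-- Step sizes which are powers of `k`, the fast ones `α` decaying more slowly than the slow
ones `β`. -/
structure StepSizes (a b α₀ β₀ : ℝ) (α β : ℕ → ℝ) : Prop where
  half_lt : 1 / 2 < a
  lt : a < b
  le_one : b ≤ 1
  α₀_pos : 0 < α₀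
  β₀_pos : 0 < β₀
  α_zero : 0 < α 0
  β_zero : 0 < β 0
  α_eq : ∀ k : ℕ, 1 ≤ k → α k = α₀ / (k : ℝ) ^ a
  β_eq : ∀ k : ℕ, 1 ≤ k → β k = β₀ / (k : ℝ) ^ b

/-! ### Power step sizes and the rates on the two time scales -/

namespace StepSizes

variable {a b α₀ β₀ : ℝ} {α β : ℕ → ℝ} (h : StepSizes a b α₀ β₀ α β)
include h

theorem α_pos (k : ℕ) : 0 < α k := by
  rcases Nat.eq_zero_or_pos k with rfl | hk
  · exact h.α_zero
  · rw [h.α_eq k hk]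
    have := h.α₀_pos
    have : (0 : ℝ) < k := by exact_mod_cast hk
    positivity

theorem β_pos (k : ℕ) : 0 < β k := by
  rcases Nat.eq_zero_or_pos k with rfl | hk
  · exact h.β_zero
  · rw [h.β_eq k hk]
    have := h.β₀_pos
    have : (0 : ℝ) < k := by exact_mod_cast hk
    positivity

theorem α_eq_rpow {k : ℕ} (hk : 1 ≤ k) : α k = α₀ * (k : ℝ) ^ (-a) := by
  rw [h.α_eq k hk, Real.rpow_neg (Nat.cast_nonneg k), div_eq_mul_inv]

theorem β_eq_rpow {k : ℕ} (hk : 1 ≤ k) : β k = β₀ * (k : ℝ) ^ (-b) := by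
  rw [h.β_eq k hk, Real.rpow_neg (Nat.cast_nonneg k), div_eq_mul_inv]

theorem ratio_eq_rpow {k : ℕ} (hk : 1 ≤ k) : β k / α k = β₀ / α₀ * (k : ℝ) ^ (-(b - a)) := by
  have hk0 : (0 : ℝ) < k := by exact_mod_cast hk
  rw [h.α_eq_rpow hk, h.β_eq_rpow hk, mul_div_mul_comm, ← Real.rpow_sub hk0]
  congr 2; ring

theorem ratio_sq_eq_rpow {k : ℕ} (hk : 1 ≤ k) :
    (β k / α k) ^ 2 = (β₀ / α₀) ^ 2 * (k : ℝ) ^ (-(2 * (b - a))) := by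
  rw [h.ratio_eq_rpow hk, mul_pow, ← Real.rpow_natCast ((k : ℝ) ^ _),
    ← Real.rpow_mul (Nat.cast_nonneg k)]
  congr 2; push_cast; ring

theorem sqrt_eq_rpow {k : ℕ} (hk : 1 ≤ k) (N : ℕ) :
    √(α k / N) = √(α₀ / N) * (k : ℝ) ^ (-(a / 2)) := by
  have hk0 : (0 : ℝ) < k := by exact_mod_cast hk
  rw [h.α_eq_rpow hk, mul_div_right_comm, Real.sqrt_mul (by have := h.α₀_pos; positivity),
    Real.sqrt_eq_rpow ((k : ℝ) ^ _), ← Real.rpow_mul hk0.le]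
  congr 2; ring

theorem tendsto_α : Tendsto α atTop (𝓝 0) := by
  have : Tendsto (fun k : ℕ => α₀ * (k : ℝ) ^ (-a)) atTop (𝓝 (α₀ * 0)) :=
    ((tendsto_rpow_neg_atTop (by linarith [h.half_lt])).comp
      tendsto_natCast_atTop_atTop).const_mul _
  rw [mul_zero] at this
  exact this.congr' ((eventually_ge_atTop 1).mono fun k hk => (h.α_eq_rpow hk).symm)

theorem tendsto_β : Tendsto β atTop (𝓝 0) := by
  have : Tendsto (fun k : ℕ => β₀ * (k : ℝ) ^ (-b)) atTop (𝓝 (β₀ * 0)) :=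
    ((tendsto_rpow_neg_atTop (by linarith [h.half_lt, h.lt])).comp
      tendsto_natCast_atTop_atTop).const_mul _
  rw [mul_zero] at this
  exact this.congr' ((eventually_ge_atTop 1).mono fun k hk => (h.β_eq_rpow hk).symm)

theorem tendsto_ratio : Tendsto (fun k => β k / α k) atTop (𝓝 0) := by
  have : Tendsto (fun k : ℕ => β₀ / α₀ * (k : ℝ) ^ (-(b - a))) atTop (𝓝 (β₀ / α₀ * 0)) :=
    ((tendsto_rpow_neg_atTop (by linarith [h.lt])).comp
      tendsto_natCast_atTop_atTop).const_mul _
  rw [mul_zero] at this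
  exact this.congr' ((eventually_ge_atTop 1).mono fun k hk => (h.ratio_eq_rpow hk).symm)

/-- Here `a < b ≤ 1`, so `1 / k` is of smaller order than `α k`, whatever the constants. -/
theorem eventually_div_le_α {p κ : ℝ} (hκ : 0 < κ) : ∀ᶠ k : ℕ in atTop, p / k ≤ κ * α k := by
  have : Tendsto (fun k : ℕ => p * (k : ℝ) ^ (-(1 - a))) atTop (𝓝 (p * 0)) :=
    ((tendsto_rpow_neg_atTop (by linarith [h.lt, h.le_one])).comp
      tendsto_natCast_atTop_atTop).const_mul _
  rw [mul_zero] at this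
  filter_upwards [this.eventually_lt_const (mul_pos hκ h.α₀_pos), eventually_ge_atTop 1]
    with k hk hk1
  have hk0 : (0 : ℝ) < k := by exact_mod_cast hk1
  have e : p / k = p * (k : ℝ) ^ (-(1 - a)) * (k : ℝ) ^ (-a) := by
    rw [mul_assoc, ← Real.rpow_add hk0, show -(1 - a) + -a = -1 by ring, Real.rpow_neg_one,
      div_eq_mul_inv]
  rw [e, h.α_eq_rpow hk1, ← mul_assoc]
  exact mul_le_mul_of_nonneg_right hk.le (by positivity)

/-- For `b < 1` the constants do not matter, as `1 / k` is of smaller order than `β k`. For `b = 1`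
both sides are of order `1 / k` and the constants have to be compared. -/
theorem eventually_div_le_β {p κ : ℝ} (hκ : 0 < κ) (hp : b = 1 → p ≤ κ * β₀) :
    ∀ᶠ k : ℕ in atTop, p / k ≤ κ * β k := by
  rcases h.le_one.lt_or_eq with hb | hb
  · have : Tendsto (fun k : ℕ => p * (k : ℝ) ^ (-(1 - b))) atTop (𝓝 (p * 0)) :=
      ((tendsto_rpow_neg_atTop (by linarith)).comp tendsto_natCast_atTop_atTop).const_mul _
    rw [mul_zero] at this
    filter_upwards [this.eventually_lt_const (mul_pos hκ h.β₀_pos), eventually_ge_atTop 1]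
      with k hk hk1
    have hk0 : (0 : ℝ) < k := by exact_mod_cast hk1
    have e : p / k = p * (k : ℝ) ^ (-(1 - b)) * (k : ℝ) ^ (-b) := by
      rw [mul_assoc, ← Real.rpow_add hk0, show -(1 - b) + -b = -1 by ring, Real.rpow_neg_one,
        div_eq_mul_inv]
    rw [e, h.β_eq_rpow hk1, ← mul_assoc]
    exact mul_le_mul_of_nonneg_right hk.le (by positivity)
  · filter_upwards [eventually_ge_atTop 1] with k hk1
    rw [h.β_eq k hk1, hb, Real.rpow_one, ← mul_div_assoc]
    exact div_le_div_of_nonneg_right (hp hb) (Nat.cast_nonneg k)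

/-- The free `η` is the Young weight separating the fast step from the motion of the target. The
rate balances the contraction `α` against the forcing `α² / N + β² / α`. -/
theorem exists_fast_rate {ε C R : ℝ} (hε : 0 < ε) (hC : 0 ≤ C) :
    ∃ C', 0 ≤ C' ∧ ∀ (N : ℕ), 1 ≤ N → ∀ V : ℕ → ℝ, (∀ k, 0 ≤ V k) → V 0 ≤ R →
      (∀ k η, 0 < η → V (k + 1) ≤
        (1 + η) * ((1 - 2 * ε * α k + C * α k ^ 2) * V k + C * α k ^ 2 / N) +
          (1 + 1 / η) * (C * β k ^ 2 * (1 + V k))) →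
      ∀ k, 1 ≤ k → V k ≤ C' * (α k / N + (β k / α k) ^ 2) := by
  -- All admissible pairs of a batch size and a sequence form one index type, so the comparison
  -- lemma yields a single constant.
  let Rec : ℕ × (ℕ → ℝ) → Prop := fun x => 1 ≤ x.1 ∧ (∀ k, 0 ≤ x.2 k) ∧ x.2 0 ≤ R ∧
    ∀ k η, 0 < η → x.2 (k + 1) ≤
        (1 + η) * ((1 - 2 * ε * α k + C * α k ^ 2) * x.2 k + C * α k ^ 2 / x.1) +
          (1 + 1 / η) * (C * β k ^ 2 * (1 + x.2 k))
  have hbdd : ∀ k, ∃ B, ∀ i : Subtype Rec, i.1.2 k ≤ B := fun k => by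
    induction k with
    | zero => exact ⟨R, fun i => i.2.2.2.1⟩
    | succ k ih =>
      obtain ⟨B, hB⟩ := ih
      refine ⟨2 * ((1 + C * α k ^ 2) * B + C * α k ^ 2) + 2 * (C * β k ^ 2 * (1 + B)),
        fun ⟨⟨N, V⟩, hN, hV, _, hrec⟩ => ?_⟩
      -- For a bound at a fixed `k` any weight serves; `N ≥ 1` removes the dependence on `N`.
      have h1 := hrec k 1 one_pos
      have h2 : V k ≤ B := hB ⟨⟨N, V⟩, hN, hV, ‹_›, hrec⟩
      have h3 := hV k
      dsimp only at h1 h3 hN ⊢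
      have hα := h.α_pos k
      have h4 : C * α k ^ 2 / N ≤ C * α k ^ 2 :=
        div_le_self (by positivity) (by exact_mod_cast hN)
      have h5 : (1 - 2 * ε * α k + C * α k ^ 2) * V k ≤ (1 + C * α k ^ 2) * B :=
        mul_le_mul (by nlinarith) h2 h3 (by positivity)
      have h6 : C * β k ^ 2 * (1 + V k) ≤ C * β k ^ 2 * (1 + B) := by gcongr
      linarith
  refine (exists_uniform_const_of_contraction (ι := Subtype Rec)
    (w := fun i k => i.1.2 k) (s := fun i k => α k / i.1.1 + (β k / α k) ^ 2)
    -- The floor must not depend on `N`, so it omits `α k / N`.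
    (σ := fun k => (β k / α k) ^ 2) (τ := α) (γ := fun k => ε / 2 * α k) (δ := ε / 4)
    (c := 2 * C + 2 * C / ε) (by positivity)
    (fun k _ => pow_pos (div_pos (h.β_pos k) (h.α_pos k)) 2)
    (fun i k _ => le_add_of_nonneg_left (div_nonneg (h.α_pos k).le (Nat.cast_nonneg _)))
    (fun k _ => hbdd k) (Eventually.of_forall fun k => (h.α_pos k).le) ?_ ?_ ?_).imp fun C' hC' =>
    ⟨hC'.1, fun N hN V h1 h2 h3 => hC'.2 ⟨⟨N, V⟩, hN, h1, h2, h3⟩⟩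
  · have := h.tendsto_α.const_mul (ε / 2)
    rw [mul_zero] at this
    exact (this.eventually_lt_const one_pos).mono fun k hk => hk.le
  · have t1 := h.tendsto_α.const_mul ε
    have t2 := (h.tendsto_α.const_mul (2 * C)).add ((h.tendsto_ratio.pow 2).const_mul (2 * C / ε))
    simp only [mul_zero, ne_eq, OfNat.ofNat_ne_zero, not_false_eq_true, zero_pow, add_zero]
      at t1 t2
    filter_upwards [t1.eventually_lt_const one_pos, t2.eventually_lt_const (half_pos hε)]
      with k h1 h2
    rintro ⟨⟨N, V⟩, hN, hV, _, hrec⟩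
    have hα := h.α_pos k
    have hβ := h.β_pos k
    -- With `η = ε α` half of the contraction `2 ε α` is spent on `1 + η`, while `1 + 1 / η ≤ 2 / (ε
    -- α)` turns `β²` into `α (β/α)²`. The remaining multiples of `V` are eventually below `(ε / 2)
    -- α V`, which leaves `1 - (ε / 2) α`.
    have hr := hrec k (ε * α k) (by positivity)
    have h3 := hV k
    dsimp only at hr h3 hN ⊢
    set r := β k / α k with hr_def
    have eβ : β k = r * α k := by rw [hr_def]; field_simp
    have e1 : (1 + 1 / (ε * α k)) * (C * β k ^ 2 * (1 + V k)) ≤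
        2 * C / ε * (α k * r ^ 2) * (1 + V k) := by
      have : 1 + 1 / (ε * α k) ≤ 2 / (ε * α k) := by
        rw [← sub_nonneg]
        have : 2 / (ε * α k) - (1 + 1 / (ε * α k)) = (1 - ε * α k) / (ε * α k) := by
          field_simp; ring
        rw [this]
        exact div_nonneg (by linarith) (by positivity)
      calc _ ≤ 2 / (ε * α k) * (C * β k ^ 2 * (1 + V k)) :=
            mul_le_mul_of_nonneg_right this (by positivity)
        _ = _ := by rw [eβ]; field_simp
    have e2 : (1 + ε * α k) * ((1 - 2 * ε * α k + C * α k ^ 2) * V k + C * α k ^ 2 / N) ≤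
        (1 - ε * α k + 2 * C * α k ^ 2) * V k + 2 * (C * α k ^ 2 / N) := by
      have a1 : (1 + ε * α k) * (1 - 2 * ε * α k + C * α k ^ 2) ≤
          1 - ε * α k + 2 * C * α k ^ 2 := by
        have : 0 ≤ C * α k ^ 2 * (1 - ε * α k) := mul_nonneg (by positivity) (by linarith)
        nlinarith [sq_nonneg (ε * α k)]
      have a2 : 0 ≤ C * α k ^ 2 / N := by positivity
      have a3 := mul_le_mul_of_nonneg_right a1 h3
      nlinarith
    have e3 : (2 * C * α k + 2 * C / ε * r ^ 2) * (α k * V k) ≤ ε / 2 * (α k * V k) :=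
      mul_le_mul_of_nonneg_right h2.le (by positivity)
    have e4 : C * α k ^ 2 / N = C * α k * (α k / N) := by ring
    have e5 : 0 ≤ 2 * C * α k * r ^ 2 := by positivity
    have e6 : 0 ≤ 2 * C / ε * α k * (α k / N) := by positivity
    rw [e4] at e2 hr
    nlinarith
  · filter_upwards [h.eventually_div_le_α (p := a) (κ := ε / 4) (by positivity),
      h.eventually_div_le_α (p := 2 * (b - a)) (κ := ε / 4) (by positivity),
      eventually_ge_atTop 1] with k h1 h2 hk
    intro i
    have hk0 : (0 : ℝ) < k := by exact_mod_cast hk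
    have g1 := one_sub_mul_rpow_neg_le (p := a) (by linarith [h.half_lt]) hk
    have g2 := one_sub_mul_rpow_neg_le (p := 2 * (b - a)) (by linarith [h.lt]) hk
    rw [h.ratio_sq_eq_rpow hk, h.ratio_sq_eq_rpow (Nat.le_add_left 1 k), mul_add]
    refine add_le_add ?_ ?_
    · have e : 1 - ε / 2 * α k + ε / 4 * α k ≤ 1 - a / k := by linarith
      calc _ ≤ (1 - a / k) * (α k / i.1.1) := mul_le_mul_of_nonneg_right e
            (div_nonneg (h.α_pos k).le (Nat.cast_nonneg _))
        _ = α₀ / i.1.1 * ((1 - a / k) * (k : ℝ) ^ (-a)) := by rw [h.α_eq_rpow hk]; ring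
        _ ≤ α₀ / i.1.1 * ((k + 1 : ℕ) : ℝ) ^ (-a) := mul_le_mul_of_nonneg_left g1
            (div_nonneg h.α₀_pos.le (Nat.cast_nonneg _))
        _ = _ := by rw [h.α_eq_rpow (Nat.le_add_left 1 k)]; ring
    · have e : 1 - ε / 2 * α k + ε / 4 * α k ≤ 1 - 2 * (b - a) / k := by linarith
      calc _ ≤ (1 - 2 * (b - a) / k) * ((β₀ / α₀) ^ 2 * (k : ℝ) ^ (-(2 * (b - a)))) :=
            mul_le_mul_of_nonneg_right e (by positivity)
        _ = (β₀ / α₀) ^ 2 * ((1 - 2 * (b - a) / k) * (k : ℝ) ^ (-(2 * (b - a)))) := by ring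
        _ ≤ _ := mul_le_mul_of_nonneg_left g2 (by positivity)

/-- The a priori bound `B` takes care of the early indices, where `β k * KL ≤ 1` may fail and the
recursion says nothing. -/
theorem exists_slow_rate {KL C B : ℝ} (hKL : 0 < KL)
    (hb : b = 1 → max (1 - a) (a / 2) < β₀ * KL) :
    ∃ C', 0 ≤ C' ∧ ∀ (N : ℕ), 1 ≤ N → ∀ W : ℕ → ℝ, (∀ k, 0 ≤ W k) → (∀ k, W k ≤ B) →
      (∀ k, 1 ≤ k → β k * KL ≤ 1 → W (k + 1) ≤
        (1 - KL * β k + C * β k ^ 2) * W k + C * β k * (β k / α k + √(α k / N))) →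
      ∀ k, 1 ≤ k → W k ≤ C' * (β k / α k + √(α k / N)) := by
  let Rec : ℕ × (ℕ → ℝ) → Prop := fun x => 1 ≤ x.1 ∧ (∀ k, 0 ≤ x.2 k) ∧ (∀ k, x.2 k ≤ B) ∧
    ∀ k, 1 ≤ k → β k * KL ≤ 1 → x.2 (k + 1) ≤
        (1 - KL * β k + C * β k ^ 2) * x.2 k + C * β k * (β k / α k + √(α k / x.1))
  -- Two portions `δ` of the curvature are given up, one to absorb `C β²` and one as slack for the
  -- comparison. For `b = 1` the strict inequality leaves room for both: `δ` is half the gap between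
  -- `KL` and `max (1 - a) (a / 2) / β₀`.
  obtain ⟨δ, hδ, hδK, hδ1⟩ : ∃ δ, 0 < δ ∧ 2 * δ < KL ∧
      (b = 1 → max (1 - a) (a / 2) ≤ (KL - 2 * δ) * β₀) := by
    by_cases hb1 : b = 1
    · have h1 := hb hb1
      have hβ₀ := h.β₀_pos
      have h0 : 0 < max (1 - a) (a / 2) := lt_max_of_lt_right (by linarith [h.half_lt])
      refine ⟨(KL - max (1 - a) (a / 2) / β₀) / 2, ?_, ?_, fun _ => ?_⟩
      · have : max (1 - a) (a / 2) / β₀ < KL := by rw [div_lt_iff₀ hβ₀]; linarith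
        linarith
      · have := div_pos h0 hβ₀
        linarith
      · have : (KL - 2 * ((KL - max (1 - a) (a / 2) / β₀) / 2)) * β₀ =
          max (1 - a) (a / 2) := by field_simp; ring
        rw [this]
    · exact ⟨KL / 4, by linarith, by linarith, fun h' => absurd h' hb1⟩
  refine (exists_uniform_const_of_contraction (ι := Subtype Rec)
    (w := fun i k => i.1.2 k) (s := fun i k => β k / α k + √(α k / i.1.1))
    (σ := fun k => β k / α k) (τ := β) (γ := fun k => (KL - δ) * β k) (δ := δ)
    (c := C) hδ (fun k _ => div_pos (h.β_pos k) (h.α_pos k))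
    (fun i k _ => le_add_of_nonneg_right (Real.sqrt_nonneg _))
    (fun k _ => ⟨B, fun i => i.2.2.2.1 k⟩) (Eventually.of_forall fun k => (h.β_pos k).le)
    ?_ ?_ ?_).imp fun C' hC' =>
    ⟨hC'.1, fun N hN W h1 h2 h3 => hC'.2 ⟨⟨N, W⟩, hN, h1, h2, h3⟩⟩
  · have := h.tendsto_β.const_mul (KL - δ)
    rw [mul_zero] at this
    exact (this.eventually_lt_const one_pos).mono fun k hk => hk.le
  · have t1 := h.tendsto_β.mul_const KL
    have t2 := h.tendsto_β.const_mul C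
    rw [zero_mul] at t1
    rw [mul_zero] at t2
    filter_upwards [t1.eventually_lt_const one_pos, t2.eventually_lt_const hδ,
      eventually_ge_atTop 1] with k h1 h2 hk
    rintro ⟨⟨N, W⟩, hN, hW, _, hrec⟩
    have h3 := hW k
    refine (hrec k hk h1.le).trans (add_le_add_left (mul_le_mul_of_nonneg_right ?_ h3) _)
    have := mul_le_mul_of_nonneg_right h2.le (h.β_pos k).le
    nlinarith
  · filter_upwards [h.eventually_div_le_β (p := b - a) (κ := KL - 2 * δ) (by linarith)
        (fun hb1 => ((by rw [hb1] : b - a = 1 - a).trans_le (le_max_left _ _)).trans (hδ1 hb1)),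
      h.eventually_div_le_β (p := a / 2) (κ := KL - 2 * δ) (by linarith)
        (fun hb1 => (le_max_right _ _).trans (hδ1 hb1)), eventually_ge_atTop 1] with k h1 h2 hk
    intro i
    have hk0 : (0 : ℝ) < k := by exact_mod_cast hk
    have g1 := one_sub_mul_rpow_neg_le (p := b - a) (by linarith [h.lt]) hk
    have g2 := one_sub_mul_rpow_neg_le (p := a / 2) (by linarith [h.half_lt]) hk
    rw [h.ratio_eq_rpow hk, h.ratio_eq_rpow (Nat.le_add_left 1 k), h.sqrt_eq_rpow hk,
      h.sqrt_eq_rpow (Nat.le_add_left 1 k), mul_add]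
    have hβα : 0 ≤ β₀ / α₀ := (div_pos h.β₀_pos h.α₀_pos).le
    refine add_le_add ?_ ?_
    · have e : 1 - (KL - δ) * β k + δ * β k ≤ 1 - (b - a) / k := by linarith
      calc _ ≤ (1 - (b - a) / k) * (β₀ / α₀ * (k : ℝ) ^ (-(b - a))) :=
            mul_le_mul_of_nonneg_right e (by positivity)
        _ = β₀ / α₀ * ((1 - (b - a) / k) * (k : ℝ) ^ (-(b - a))) := by ring
        _ ≤ _ := mul_le_mul_of_nonneg_left g1 hβα
    · have e : 1 - (KL - δ) * β k + δ * β k ≤ 1 - a / 2 / k := by linarith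
      calc _ ≤ (1 - a / 2 / k) * (√(α₀ / i.1.1) * (k : ℝ) ^ (-(a / 2))) :=
            mul_le_mul_of_nonneg_right e (by positivity)
        _ = √(α₀ / i.1.1) * ((1 - a / 2 / k) * (k : ℝ) ^ (-(a / 2))) := by ring
        _ ≤ _ := mul_le_mul_of_nonneg_left g2 (Real.sqrt_nonneg _)

end StepSizes

end ScalarRecursions

/-! ### Calculus on the feasible region, projection and uniform bounds -/

variable {𝒳 : Type u₁} {𝒴 : Type u₂} {𝒰 : Type u₃}
  [MeasurableSpace 𝒳] [MeasurableSpace 𝒴] [MeasurableSpace 𝒰] {d l T M N : ℕ}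

/-- Over `ℝ` the adjoint is linear, not just conjugate-linear, and it preserves norms. -/
theorem contDiff_real_adjoint {E F : Type*} [NormedAddCommGroup E] [InnerProductSpace ℝ E]
    [CompleteSpace E] [NormedAddCommGroup F] [InnerProductSpace ℝ F] [CompleteSpace F]
    {n : WithTop ℕ∞} :
    ContDiff ℝ n fun A : E →L[ℝ] F => ContinuousLinearMap.adjoint A :=
  IsBoundedLinearMap.contDiff
    ⟨⟨fun A B => map_add _ A B, fun c A => by simp⟩, 1, one_pos, fun A => by simp⟩

theorem ContDiff.real_gradient {E : Type*} [NormedAddCommGroup E] [InnerProductSpace ℝ E]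
    [CompleteSpace E] {f : E → ℝ} {m n : WithTop ℕ∞} (hf : ContDiff ℝ n f) (hmn : m + 1 ≤ n) :
    ContDiff ℝ m (gradient f) := by
  have : ContDiff ℝ m fun A : StrongDual ℝ E => (InnerProductSpace.toDual ℝ E).symm A :=
    IsBoundedLinearMap.contDiff
      ⟨⟨fun A B => map_add _ A B, fun c A => by simp⟩, 1, one_pos, fun A => by simp⟩
  exact this.comp (hf.fderiv_right hmn)

/-- Stating the bound for all large `K` lets finitely many such bounds be met by one `K`. -/
theorem ContinuousOn.eventually_norm_le {E F : Type*} [TopologicalSpace E]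
    [SeminormedAddCommGroup F] {f : E → F} {s : Set E} (hf : ContinuousOn f s)
    (hs : IsCompact s) : ∀ᶠ K : ℝ in atTop, ∀ x ∈ s, ‖f x‖ ≤ K := by
  obtain ⟨C, hC⟩ := hs.exists_bound_of_continuousOn hf
  exact (eventually_ge_atTop C).mono fun K hK x hx => (hC x hx).trans hK

theorem ContDiffOn.eventually_norm_sub_le {E F : Type*} [NormedAddCommGroup E]
    [NormedSpace ℝ E] [NormedAddCommGroup F] [NormedSpace ℝ F] {f : E → F} {s : Set E}
    (hf : ContDiffOn ℝ 1 f s) (hs : IsCompact s) (hc : Convex ℝ s) :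
    ∀ᶠ K : ℝ in atTop, ∀ x ∈ s, ∀ y ∈ s, ‖f x - f y‖ ≤ K * ‖x - y‖ := by
  obtain ⟨C, hC⟩ := hf.exists_lipschitzOnWith one_ne_zero hc hs
  exact (eventually_ge_atTop (C : ℝ)).mono fun K hK x hx y hy =>
    (hC.norm_sub_le hx hy).trans (mul_le_mul_of_nonneg_right hK (norm_nonneg _))

/-- A vector field with uniformly negative derivative is strongly monotone. -/
theorem inner_sub_le_of_inner_fderivWithin_le {E : Type*} [NormedAddCommGroup E]
    [InnerProductSpace ℝ E] {f : E → E} {s : Set E} (hs : Convex ℝ s)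
    (hf : DifferentiableOn ℝ f s) {c : ℝ}
    (hc : ∀ x ∈ s, ∀ v, inner ℝ v (fderivWithin ℝ f s x v) ≤ -c * ‖v‖ ^ 2)
    {x y : E} (hx : x ∈ s) (hy : y ∈ s) :
    inner ℝ (y - x) (f y - f x) ≤ -c * ‖y - x‖ ^ 2 := by
  set g : ℝ → E := fun r => x + r • (y - x) with hg
  have hgs : Set.MapsTo g (Set.Icc 0 1) s := fun r hr => hs.add_smul_sub_mem hx hy hr
  have hgd : ∀ r, HasDerivAt g (y - x) r := fun r => by
    have := ((hasDerivAt_id r).smul_const (y - x)).const_add x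
    rwa [one_smul] at this
  have hd : ∀ r ∈ Set.Icc (0 : ℝ) 1, HasDerivWithinAt (fun r => inner ℝ (y - x) (f (g r)))
      (inner ℝ (y - x) (fderivWithin ℝ f s (g r) (y - x))) (Set.Icc 0 1) r := fun r hr => by
    have h1 := ((hf (g r) (hgs hr)).hasFDerivWithinAt).comp_hasDerivWithinAt r
      (hgd r).hasDerivWithinAt hgs
    simpa using (hasDerivWithinAt_const r (Set.Icc (0 : ℝ) 1) (y - x)).inner ℝ h1
  have hd' : ∀ r ∈ interior (Set.Icc (0 : ℝ) 1), HasDerivAt (fun r => inner ℝ (y - x) (f (g r)))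
      (inner ℝ (y - x) (fderivWithin ℝ f s (g r) (y - x))) r := fun r hr =>
    (hd r (interior_subset hr)).hasDerivAt (mem_interior_iff_mem_nhds.1 hr)
  -- The mean value inequality along the segment from `x` to `y`, which convexity keeps inside `s`.
  have := (convex_Icc (0 : ℝ) 1).image_sub_le_mul_sub_of_deriv_le
    (fun r hr => (hd r hr).continuousWithinAt)
    (fun r hr => (hd' r hr).differentiableAt.differentiableWithinAt)
    (C := -c * ‖y - x‖ ^ 2) (fun r hr => by
      rw [(hd' r hr).deriv]
      exact hc _ (hgs (interior_subset hr)) _) 0 (by simp) 1 (by simp) zero_le_one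
  simpa [hg, inner_sub_right] using this

/-- The variational inequality `⟪x - y, z - y⟫ ≤ 0` gives `‖y - z‖² ≤ ⟪y - z, x - z⟫`, and
Cauchy–Schwarz concludes. -/
theorem IsNearest.norm_sub_le {Λ : Set (Vec l)} (hΛ : Convex ℝ Λ) {x y z : Vec l}
    (h : IsNearest Λ x y) (hz : z ∈ Λ) : ‖y - z‖ ≤ ‖x - z‖ := by
  have hne : Nonempty Λ := ⟨⟨y, h.1⟩⟩
  have h1 : ‖x - y‖ = ⨅ v : Λ, ‖x - v‖ := le_antisymm
    (le_ciInf fun v => by simpa [dist_eq_norm] using h.2 v v.2)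
    (ciInf_le ⟨0, by rintro _ ⟨v, rfl⟩; exact norm_nonneg _⟩ (⟨y, h.1⟩ : Λ))
  have h2 := (norm_eq_iInf_iff_real_inner_le_zero hΛ h.1).1 h1 z hz
  have h3 : inner ℝ (y - z) (y - z) ≤ inner ℝ (y - z) (x - z) := by
    have e : inner ℝ (y - z) (x - z) =
        inner ℝ (y - z) (y - z) - (inner ℝ (x - y) (z - y) : ℝ) := by
      rw [show x - z = (y - z) + (x - y) by abel, inner_add_right,
        show z - y = -(y - z) by abel, inner_neg_right, real_inner_comm (x - y)]
      ring
    linarith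
  rw [real_inner_self_eq_norm_sq] at h3
  have h4 := h3.trans (real_inner_le_norm _ _)
  rcases (norm_nonneg (y - z)).eq_or_lt with h0 | h0
  · rw [← h0]; exact norm_nonneg _
  · nlinarith

namespace PosteriorProblem

/-- The target `∇_θ p(Y_t | θ) / p(Y_t | θ)` at `θ = θ(u_m; λ)` of the tracker `D m t`. -/
def target (P : PosteriorProblem 𝒳 𝒴 𝒰 d l T) (v : 𝒰) (t : Fin T) (lam : Vec l) : Vec d :=
  (P.lik (P.obs t) (P.reparam v lam))⁻¹ • gradient (P.lik (P.obs t)) (P.reparam v lam)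

/-- Uniform bounds on the data of the problem over the feasible region. -/
structure UniformBounds (P : PosteriorProblem 𝒳 𝒴 𝒰 d l T) (u : Fin M → 𝒰) (lamBar : Vec l)
    (KL K ε : ℝ) : Prop where
  one_le : 1 ≤ K
  lik_ge : ∀ m t, ∀ lam ∈ P.feasible, ε ≤ P.lik (P.obs t) (P.reparam (u m) lam)
  lik_le : ∀ m t, ∀ lam ∈ P.feasible, ‖P.lik (P.obs t) (P.reparam (u m) lam)‖ ≤ K
  grad_le : ∀ m t, ∀ lam ∈ P.feasible, ‖gradient (P.lik (P.obs t)) (P.reparam (u m) lam)‖ ≤ K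
  target_le : ∀ m t, ∀ lam ∈ P.feasible, ‖P.target (u m) t lam‖ ≤ K
  target_lip : ∀ m t, ∀ lam ∈ P.feasible, ∀ lam' ∈ P.feasible,
    ‖P.target (u m) t lam - P.target (u m) t lam'‖ ≤ K * ‖lam - lam'‖
  jac_le : ∀ m, ∀ lam ∈ P.feasible, ‖P.jac (u m) lam‖ ≤ K
  sub_le : ∀ lam ∈ P.feasible, ‖lam - lamBar‖ ≤ K
  saaGrad_le : ∀ lam ∈ P.feasible, ‖P.saaGrad u lam‖ ≤ K
  saaGrad_lip : ∀ lam ∈ P.feasible, ‖P.saaGrad u lam‖ ≤ K * ‖lam - lamBar‖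
  saaGrad_mono : ∀ lam ∈ P.feasible,
    inner ℝ (lam - lamBar) (P.saaGrad u lam) ≤ -KL * ‖lam - lamBar‖ ^ 2

section Regularity

variable {P : PosteriorProblem 𝒳 𝒴 𝒰 d l T} {u : Fin M → 𝒰}

theorem Regular.contDiffOn_target (h : P.Regular u) (m : Fin M) (t : Fin T) :
    ContDiffOn ℝ 1 (P.target (u m) t) P.feasible := by
  have h1 := (h.reparam_smooth m).of_le one_le_two
  exact ContDiffOn.smul (ContDiffOn.inv
    (((h.lik_smooth t).of_le one_le_two).comp_contDiffOn h1) fun lam _ => (h.lik_pos t _).ne')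
    (((h.lik_smooth t).real_gradient (m := 1)
      (by norm_num [one_add_one_eq_two])).comp_contDiffOn h1)

/-- A convex set with nonempty interior has unique derivatives at every point, so `fderivWithin`
costs just one order of smoothness. -/
theorem Regular.contDiffOn_jac (h : P.Regular u) (hne : (interior P.feasible).Nonempty)
    (m : Fin M) : ContDiffOn ℝ 1 (P.jac (u m)) P.feasible :=
  contDiff_real_adjoint.comp_contDiffOn ((h.reparam_smooth m).fderivWithin
    (uniqueDiffOn_convex h.convex hne) (by norm_num [one_add_one_eq_two]))

theorem Regular.contDiffOn_saaGrad (h : P.Regular u) (hne : (interior P.feasible).Nonempty) :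
    ContDiffOn ℝ 1 (P.saaGrad u) P.feasible := by
  refine ContDiffOn.const_smul _ (ContDiffOn.sum fun m _ => ?_)
  exact (h.contDiffOn_jac hne m).clm_apply (((ContDiffOn.sum fun t _ =>
    h.contDiffOn_target m t).add (h.priorScore_smooth m)).sub (h.varScore_smooth m))

/-- Everything follows from compactness and convexity of the feasible region. The bounds for the
gradient at `lamBar` come from Lipschitz continuity and monotonicity, since the gradient vanishes
there. -/
theorem Regular.exists_uniformBounds (h : P.Regular u) {lamBar : Vec l}
    (hint : lamBar ∈ interior P.feasible) (hzero : P.saaGrad u lamBar = 0) {KL : ℝ}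
    (hcurv : ∀ lam ∈ P.feasible, ∀ v : Vec l,
      inner ℝ v (fderivWithin ℝ (P.saaGrad u) P.feasible lam v) ≤ -KL * ‖v‖ ^ 2) :
    ∃ K ε, 0 < ε ∧ P.UniformBounds u lamBar KL K ε := by
  have hne : (interior P.feasible).Nonempty := ⟨_, hint⟩
  have hmem := interior_subset hint
  have hlik : ∀ m t, ContinuousOn (fun lam => P.lik (P.obs t) (P.reparam (u m) lam))
      P.feasible := fun m t =>
    (h.lik_smooth t).continuous.comp_continuousOn (h.reparam_smooth m).continuousOn
  have hG := h.contDiffOn_saaGrad hne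
  -- Each likelihood attains a positive minimum; working with all small `ε` handles the finitely
  -- many `m` and `t` together.
  have hε : ∀ᶠ ε : ℝ in 𝓝[>] 0, ∀ m t, ∀ lam ∈ P.feasible,
      ε ≤ P.lik (P.obs t) (P.reparam (u m) lam) := by
    rw [eventually_all]; intro m; rw [eventually_all]; intro t
    obtain ⟨x, _, hmin⟩ := h.compact.exists_isMinOn ⟨_, hmem⟩ (hlik m t)
    filter_upwards [Ioc_mem_nhdsGT (h.lik_pos t (P.reparam (u m) x))] with ε hε lam hlam
    exact hε.2.trans (hmin hlam)
  obtain ⟨ε, hε, hε0⟩ := (hε.and self_mem_nhdsWithin).exists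
  have e1 : ∀ᶠ K : ℝ in atTop, ∀ m t, ∀ lam ∈ P.feasible,
      ‖P.lik (P.obs t) (P.reparam (u m) lam)‖ ≤ K := by
    simp_rw [eventually_all]
    exact fun m t => (hlik m t).eventually_norm_le h.compact
  have e2 : ∀ᶠ K : ℝ in atTop, ∀ m t, ∀ lam ∈ P.feasible,
      ‖gradient (P.lik (P.obs t)) (P.reparam (u m) lam)‖ ≤ K := by
    simp_rw [eventually_all]
    exact fun m t => ContinuousOn.eventually_norm_le
      (((h.lik_smooth t).real_gradient (m := 1)
        (by norm_num [one_add_one_eq_two])).continuous.comp_continuousOn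
          (h.reparam_smooth m).continuousOn) h.compact
  have e3 : ∀ᶠ K : ℝ in atTop, ∀ m t, ∀ lam ∈ P.feasible, ‖P.target (u m) t lam‖ ≤ K := by
    simp_rw [eventually_all]
    exact fun m t => (h.contDiffOn_target m t).continuousOn.eventually_norm_le h.compact
  have e4 : ∀ᶠ K : ℝ in atTop, ∀ m t, ∀ lam ∈ P.feasible, ∀ lam' ∈ P.feasible,
      ‖P.target (u m) t lam - P.target (u m) t lam'‖ ≤ K * ‖lam - lam'‖ := by
    rw [eventually_all]; intro m; rw [eventually_all]; intro t
    exact (h.contDiffOn_target m t).eventually_norm_sub_le h.compact h.convex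
  have e5 : ∀ᶠ K : ℝ in atTop, ∀ m, ∀ lam ∈ P.feasible, ‖P.jac (u m) lam‖ ≤ K := by
    rw [eventually_all]
    exact fun m => (h.contDiffOn_jac hne m).continuousOn.eventually_norm_le h.compact
  have e6 : ∀ᶠ K : ℝ in atTop, ∀ lam ∈ P.feasible, ‖lam - lamBar‖ ≤ K :=
    ContinuousOn.eventually_norm_le (by fun_prop) h.compact
  obtain ⟨K, h0, h1, h2, h3, h4, h5, h6, h7, h8⟩ := ((eventually_ge_atTop (1 : ℝ)).and
    (e1.and (e2.and (e3.and (e4.and (e5.and (e6.and ((hG.continuousOn.eventually_norm_le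
      h.compact).and (hG.eventually_norm_sub_le h.compact h.convex))))))))).exists
  refine ⟨K, ε, hε0, h0, hε, h1, h2, h3, h4, h5, h6, h7, fun lam hlam => ?_, fun lam hlam => ?_⟩
  · simpa [hzero] using h8 lam hlam lamBar hmem
  · simpa [hzero] using inner_sub_le_of_inner_fderivWithin_le h.convex
      (hG.differentiableOn one_ne_zero) hcurv hmem hlam

end Regularity

namespace UniformBounds

variable {P : PosteriorProblem 𝒳 𝒴 𝒰 d l T} {u : Fin M → 𝒰} {lamBar : Vec l} {KL K ε : ℝ}

/-- The prior and variational scores cancel, so only tracker errors pass through the Jacobians. The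
factor `M⁻¹` is bounded by `1`. -/
theorem norm_slowDir_sub_le (h : P.UniformBounds u lamBar KL K ε) (Dk : Fin M → Fin T → Vec d)
    {lam : Vec l} (hlam : lam ∈ P.feasible) :
    ‖P.slowDir u Dk lam - P.saaGrad u lam‖ ≤
      K * ∑ m, ∑ t, ‖Dk m t - P.target (u m) t lam‖ := by
  have e : P.slowDir u Dk lam - P.saaGrad u lam =
      (M : ℝ)⁻¹ • ∑ m, P.jac (u m) lam (∑ t, (Dk m t - P.target (u m) t lam)) := by
    rw [saaGrad, slowDir, slowDir, ← smul_sub, ← Finset.sum_sub_distrib]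
    congr 1
    refine Finset.sum_congr rfl fun m _ => ?_
    rw [← map_sub, Finset.sum_sub_distrib]
    simp only [target]
    congr 1
    abel
  have h1 : ‖∑ m, P.jac (u m) lam (∑ t, (Dk m t - P.target (u m) t lam))‖ ≤
      K * ∑ m, ∑ t, ‖Dk m t - P.target (u m) t lam‖ := by
    rw [Finset.mul_sum]
    refine norm_sum_le_of_le _ fun m _ => ?_
    exact (ContinuousLinearMap.le_opNorm _ _).trans (mul_le_mul (h.jac_le m lam hlam)
      (norm_sum_le _ _) (norm_nonneg _) (zero_le_one.trans h.one_le))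
  rw [e, norm_smul]
  refine (mul_le_of_le_one_left (norm_nonneg _) ?_).trans h1
  rw [norm_inv, Real.norm_natCast]
  exact Nat.cast_inv_le_one M

/-- One gradient step on the sample-average problem is a contraction towards the maximizer. -/
theorem norm_gradientStep_le (h : P.UniformBounds u lamBar KL K ε) {β : ℝ} (hβ : 0 ≤ β)
    (hβK : β * KL ≤ 1) {lam : Vec l} (hlam : lam ∈ P.feasible) :
    ‖lam + β • P.saaGrad u lam - lamBar‖ ≤
      (1 - KL * β + K ^ 2 * β ^ 2) * ‖lam - lamBar‖ := by
  have h1 := h.saaGrad_lip lam hlam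
  have h2 := h.saaGrad_mono lam hlam
  have hc : 0 ≤ 1 - KL * β + K ^ 2 * β ^ 2 := by nlinarith [sq_nonneg (K * β)]
  -- With `x = KL β` and `y = K² β²`, the squared step is at most `1 - 2x + y` times the squared
  -- distance, and `(1 - x + y)²` exceeds this factor by `(x - y)² + y`.
  refine le_of_sq_le_sq ?_ (mul_nonneg hc (norm_nonneg _))
  rw [show lam + β • P.saaGrad u lam - lamBar = (lam - lamBar) + β • P.saaGrad u lam by abel,
    norm_add_sq_real, inner_smul_right, norm_smul, Real.norm_of_nonneg hβ]
  have h3 : (β * ‖P.saaGrad u lam‖) ^ 2 ≤ (β * (K * ‖lam - lamBar‖)) ^ 2 := by gcongr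
  have h4 := mul_le_mul_of_nonneg_left h2 hβ
  have h5 : 0 ≤ (K ^ 2 * β ^ 2 * (1 - KL * β)) * ‖lam - lamBar‖ ^ 2 :=
    mul_nonneg (mul_nonneg (by positivity) (by linarith)) (by positivity)
  nlinarith [sq_nonneg (KL * β * ‖lam - lamBar‖), sq_nonneg (K ^ 2 * β ^ 2 * ‖lam - lamBar‖),
    sq_nonneg (K * β * ‖lam - lamBar‖)]

end UniformBounds

end PosteriorProblem

/-! ### Splitting a fast step into drift and centred noise -/

namespace PosteriorProblem

/-- The centred single-run increment of a tracker `z.1` at the parameter `z.2`. -/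
def noise (P : PosteriorProblem 𝒳 𝒴 𝒰 d l T) (t : Fin T) (p : (Vec d × Vec d) × 𝒳) : Vec d :=
  P.G1 p.2 (P.obs t) p.1.2 - gradient (P.lik (P.obs t)) p.1.2 -
    (P.G2 p.2 (P.obs t) p.1.2 - P.lik (P.obs t) p.1.2) • p.1.1

/-- The mean error of a tracker `z.1` at the parameter `z.2` after a step of size `c`. -/
def drift (P : PosteriorProblem 𝒳 𝒴 𝒰 d l T) (t : Fin T) (c : ℝ) (z : Vec d × Vec d) : Vec d :=
  (1 - c * P.lik (P.obs t) z.2) •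
    (z.1 - (P.lik (P.obs t) z.2)⁻¹ • gradient (P.lik (P.obs t)) z.2)

/-- The law of the latent variable at the second component of a pair. -/
def latentAt (P : PosteriorProblem 𝒳 𝒴 𝒰 d l T) : Kernel (Vec d × Vec d) 𝒳 :=
  P.latent.comap Prod.snd measurable_snd

instance (P : PosteriorProblem 𝒳 𝒴 𝒰 d l T) : IsMarkovKernel P.latentAt :=
  haveI := P.latent_prob
  inferInstanceAs (IsMarkovKernel (P.latent.comap Prod.snd measurable_snd))

variable {P : PosteriorProblem 𝒳 𝒴 𝒰 d l T} {u : Fin M → 𝒰}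

theorem Regular.measurable_lik (h : P.Regular u) (t : Fin T) : Measurable (P.lik (P.obs t)) :=
  (h.lik_smooth t).continuous.measurable

theorem Regular.measurable_gradient (h : P.Regular u) (t : Fin T) :
    Measurable (gradient (P.lik (P.obs t))) :=
  ((h.lik_smooth t).real_gradient (m := 0) (by norm_num)).continuous.measurable

theorem Regular.measurable_noise (h : P.Regular u) (t : Fin T) : Measurable (P.noise t) := by
  have h1 : Measurable fun p : (Vec d × Vec d) × 𝒳 => P.G1 p.2 (P.obs t) p.1.2 :=
    (P.G1_meas t).comp (measurable_snd.prodMk (measurable_snd.comp measurable_fst))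
  have h2 : Measurable fun p : (Vec d × Vec d) × 𝒳 => P.G2 p.2 (P.obs t) p.1.2 :=
    (P.G2_meas t).comp (measurable_snd.prodMk (measurable_snd.comp measurable_fst))
  have h3 := h.measurable_lik t
  have h4 := h.measurable_gradient t
  unfold noise
  fun_prop

theorem Regular.measurable_drift (h : P.Regular u) (t : Fin T) (c : ℝ) :
    Measurable (P.drift t c) := by
  have h3 := h.measurable_lik t
  have h4 := h.measurable_gradient t
  unfold drift
  fun_prop

theorem Unbiased.integrable_centered1 (h : P.Unbiased) (t : Fin T) (θ : Vec d) :
    Integrable (fun x => P.G1 x (P.obs t) θ - gradient (P.lik (P.obs t)) θ) (P.latent θ) :=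
  have := P.latent_prob
  (h.int1 t θ).sub (integrable_const _)

theorem Unbiased.integrable_centered2 (h : P.Unbiased) (t : Fin T) (θ : Vec d) :
    Integrable (fun x => P.G2 x (P.obs t) θ - P.lik (P.obs t) θ) (P.latent θ) :=
  have := P.latent_prob
  (h.int2 t θ).sub (integrable_const _)

theorem Unbiased.integrable_noise (h : P.Unbiased) (t : Fin T) (z : Vec d × Vec d) :
    Integrable (fun x => P.noise t (z, x)) (P.latentAt z) := by
  unfold noise
  exact Integrable.sub (μ := P.latent z.2) (h.integrable_centered1 t z.2)
    (Integrable.smul_const (h.integrable_centered2 t z.2) z.1)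

theorem Unbiased.integral_noise (h : P.Unbiased) (t : Fin T) (z : Vec d × Vec d) :
    ∫ x, P.noise t (z, x) ∂P.latentAt z = 0 := by
  have := P.latent_prob
  change ∫ x, ((P.G1 x (P.obs t) z.2 - gradient (P.lik (P.obs t)) z.2) -
    (P.G2 x (P.obs t) z.2 - P.lik (P.obs t) z.2) • z.1) ∂P.latent z.2 = 0
  rw [integral_sub (h.integrable_centered1 t z.2) ((h.integrable_centered2 t z.2).smul_const z.1),
    integral_smul_const, integral_sub (h.int1 t z.2) (integrable_const _),
    integral_sub (h.int2 t z.2) (integrable_const _), h.mean1, h.mean2]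
  simp

/-- The factor `4` is Cauchy–Schwarz for four summands. The tracker enters the bound because the
likelihood estimator multiplies it. -/
theorem norm_noise_sq_le (P : PosteriorProblem 𝒳 𝒴 𝒰 d l T) (t : Fin T) {K : ℝ}
    (z : Vec d × Vec d) (x : 𝒳) (h1 : ‖gradient (P.lik (P.obs t)) z.2‖ ≤ K)
    (h2 : ‖P.lik (P.obs t) z.2‖ ≤ K) :
    ‖P.noise t (z, x)‖ ^ 2 ≤ 4 * (‖P.G1 x (P.obs t) z.2‖ ^ 2 +
      ‖P.G2 x (P.obs t) z.2‖ ^ 2 * ‖z.1‖ ^ 2 + K ^ 2 * (1 + ‖z.1‖ ^ 2)) := by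
  have hb : ‖P.noise t (z, x)‖ ≤ ‖P.G1 x (P.obs t) z.2‖ + K +
      (‖P.G2 x (P.obs t) z.2‖ + K) * ‖z.1‖ := by
    refine (norm_sub_le _ _).trans (add_le_add ((norm_sub_le _ _).trans (by simpa using h1)) ?_)
    rw [norm_smul]
    exact mul_le_mul_of_nonneg_right ((norm_sub_le _ _).trans (by simpa using h2)) (norm_nonneg _)
  have hb2 := pow_le_pow_left₀ (norm_nonneg _) hb 2
  set p := ‖P.G1 x (P.obs t) z.2‖
  set q := ‖P.G2 x (P.obs t) z.2‖ * ‖z.1‖ with hq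
  set r := K * ‖z.1‖ with hr
  have e : (p + K + (‖P.G2 x (P.obs t) z.2‖ + K) * ‖z.1‖) ^ 2 = (p + K + q + r) ^ 2 := by ring
  have e2 : ‖P.G2 x (P.obs t) z.2‖ ^ 2 * ‖z.1‖ ^ 2 = q ^ 2 := by ring
  have e3 : K ^ 2 * (1 + ‖z.1‖ ^ 2) = K ^ 2 + r ^ 2 := by ring
  rw [e2, e3]
  rw [e] at hb2
  nlinarith [sq_nonneg (p - K), sq_nonneg (p - q), sq_nonneg (p - r), sq_nonneg (K - q),
    sq_nonneg (K - r), sq_nonneg (q - r)]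

/-- The target is the equilibrium of the mean step: with `g = ∇p / p` one has `z + c (∇p - p z) - g
= (1 - c p) (z - g)`. -/
theorem drift_add_noise (P : PosteriorProblem 𝒳 𝒴 𝒰 d l T) (t : Fin T) (c : ℝ) (hN : 1 ≤ N)
    (z : Vec d × Vec d) (x : Fin N → 𝒳) (hz : 0 < P.lik (P.obs t) z.2) :
    P.drift t c z + c • ((N : ℝ)⁻¹ • ∑ i, P.noise t (z, x i)) =
      z.1 + c • (((N : ℝ)⁻¹ • ∑ i, P.G1 (x i) (P.obs t) z.2) -
        ((N : ℝ)⁻¹ * ∑ i, P.G2 (x i) (P.obs t) z.2) • z.1) -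
      (P.lik (P.obs t) z.2)⁻¹ • gradient (P.lik (P.obs t)) z.2 := by
  have hN0 : (N : ℝ) ≠ 0 := by positivity
  have e : (N : ℝ)⁻¹ • ∑ i, P.noise t (z, x i) =
      ((N : ℝ)⁻¹ • ∑ i, P.G1 (x i) (P.obs t) z.2) - gradient (P.lik (P.obs t)) z.2 -
        (((N : ℝ)⁻¹ * ∑ i, P.G2 (x i) (P.obs t) z.2) - P.lik (P.obs t) z.2) • z.1 := by
    simp only [noise, Finset.sum_sub_distrib, ← Finset.sum_smul, Finset.sum_const,
      Finset.card_univ, Fintype.card_fin, smul_sub, smul_smul, ← Nat.cast_smul_eq_nsmul ℝ,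
      mul_sub, inv_mul_cancel₀ hN0, one_smul, smul_eq_mul, inv_mul_cancel_left₀ hN0]
  rw [e, drift]
  have e2 : gradient (P.lik (P.obs t)) z.2 = P.lik (P.obs t) z.2 •
      ((P.lik (P.obs t) z.2)⁻¹ • gradient (P.lik (P.obs t)) z.2) := by
    rw [smul_smul, mul_inv_cancel₀ hz.ne', one_smul]
  set g := (P.lik (P.obs t) z.2)⁻¹ • gradient (P.lik (P.obs t)) z.2
  rw [e2]
  module

end PosteriorProblem

/-! ### One fast step along a run -/

section Run

variable {P : PosteriorProblem 𝒳 𝒴 𝒰 d l T} {u : Fin M → 𝒰} {α β : ℕ → ℝ}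
  {Ω : Type w} [MeasurableSpace Ω] {μ : Measure Ω} {X : ℕ → Fin M → Fin N → Ω → 𝒳}
  {D : ℕ → Fin M → Fin T → Ω → Vec d} {lam : ℕ → Ω → Vec l}

/-- The error of the tracker belonging to the outer sample `q.1` and the observation `q.2`. -/
def trackErr (P : PosteriorProblem 𝒳 𝒴 𝒰 d l T) (u : Fin M → 𝒰)
    (D : ℕ → Fin M → Fin T → Ω → Vec d) (lam : ℕ → Ω → Vec l) (k : ℕ) (q : Fin M × Fin T)
    (ω : Ω) : Vec d :=
  D k q.1 q.2 ω - P.target (u q.1) q.2 (lam k ω)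

/-- The total mean square error of the trackers at time `k`. -/
def trackMSE (P : PosteriorProblem 𝒳 𝒴 𝒰 d l T) (u : Fin M → 𝒰) (μ : Measure Ω)
    (D : ℕ → Fin M → Fin T → Ω → Vec d) (lam : ℕ → Ω → Vec l) (k : ℕ) : ℝ :=
  ∑ q, ∫ ω, ‖trackErr P u D lam k q ω‖ ^ 2 ∂μ

theorem trackMSE_nonneg (k : ℕ) : 0 ≤ trackMSE P u μ D lam k :=
  Finset.sum_nonneg fun _ _ => integral_nonneg fun _ => by positivity

namespace IsNMTSRun

theorem lam_mem (h : IsNMTSRun P u α β μ X D lam) (k : ℕ) (ω : Ω) : lam k ω ∈ P.feasible := by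
  cases k with
  | zero => exact h.init ω
  | succ k => exact (h.slow k ω).1

/-- The re-parameterization is only known to be continuous on the feasible region, so `lam k` is
first regarded as a map into that subtype. -/
theorem measurable_param (h : IsNMTSRun P u α β μ X D lam) (hreg : P.Regular u) (k : ℕ)
    (m : Fin M) : Measurable[MeasurableSpace.comap (lam k) inferInstance]
      fun ω => P.reparam (u m) (lam k ω) := by
  have h1 : Continuous (P.feasible.domRestrict (P.reparam (u m))) :=
    (hreg.reparam_smooth m).continuousOn.domRestrict
  have h2 : Measurable[MeasurableSpace.comap (lam k) inferInstance]
      fun ω => (⟨lam k ω, h.lam_mem k ω⟩ : P.feasible) :=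
    (comap_measurable (lam k)).subtype_mk
  exact h1.measurable.comp h2

theorem measurable_param' (h : IsNMTSRun P u α β μ X D lam) (hreg : P.Regular u) (k : ℕ)
    (m : Fin M) : Measurable fun ω => P.reparam (u m) (lam k ω) :=
  (h.measurable_param hreg k m).mono (h.lam_meas k).comap_le le_rfl

/-- The tracker and its parameter are determined by the history, so sampling given the history is
sampling given this pair. A single block is involved, hence the joint law over blocks plays no role.
-/
theorem condSample (h : IsNMTSRun P u α β μ X D lam) (hreg : P.Regular u) (k : ℕ)
    (m : Fin M) (t : Fin T) :
    CondSample μ (fun ω => (D k m t ω, P.reparam (u m) (lam k ω))) (X k m) P.latentAt := by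
  intro A hA B hB
  refine h.sampling k m _ ?_ B hB
  have hle : (MeasurableSpace.comap (lam k) inferInstance ⊔
      ⨆ m, ⨆ t, MeasurableSpace.comap (D k m t) inferInstance) ≤ history D lam k :=
    le_iSup₂_of_le (f := fun j (_ : j ∈ Set.Iic k) =>
      (MeasurableSpace.comap (lam j) inferInstance ⊔
        ⨆ m, ⨆ t, MeasurableSpace.comap (D j m t) inferInstance)) k (Set.mem_Iic.2 le_rfl) le_rfl
  have h1 : Measurable[history D lam k] (D k m t) := (comap_measurable (D k m t)).mono
    (((le_iSup₂_of_le (f := fun m t => MeasurableSpace.comap (D k m t) inferInstance)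
      m t le_rfl).trans le_sup_right).trans hle) le_rfl
  have h2 : Measurable[history D lam k] fun ω => P.reparam (u m) (lam k ω) :=
    (h.measurable_param hreg k m).mono (le_sup_left.trans hle) le_rfl
  exact (h1.prodMk h2) hA

theorem measurable_target (h : IsNMTSRun P u α β μ X D lam) (hreg : P.Regular u) (k : ℕ)
    (m : Fin M) (t : Fin T) : Measurable fun ω => P.target (u m) t (lam k ω) := by
  have h1 := hreg.measurable_lik t
  have h2 := hreg.measurable_gradient t
  have h3 := h.measurable_param' hreg k m
  exact ((h1.comp h3).inv).smul (h2.comp h3)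

variable [IsProbabilityMeasure μ] {lamBar : Vec l} {KL K ε C₁ C₂ ε' R : ℝ}

theorem memLp_target (h : IsNMTSRun P u α β μ X D lam) (hreg : P.Regular u)
    (hb : P.UniformBounds u lamBar KL K ε) (k : ℕ) (m : Fin M) (t : Fin T) :
    MemLp (fun ω => P.target (u m) t (lam k ω)) 2 μ :=
  MemLp.of_bound (h.measurable_target hreg k m t).aestronglyMeasurable K
    (ae_of_all _ fun ω => hb.target_le m t _ (h.lam_mem k ω))

/-- For fixed `ω` the tracker is a constant in the inner integral, so the conditional moment bounds
apply and only its second moment remains. -/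
theorem lintegral_noise_le (h : IsNMTSRun P u α β μ X D lam)
    (hb : P.UniformBounds u lamBar KL K ε) (hC₁ : 0 < C₁) (hC₂ : 0 < C₂)
    (hm : MomentBounds P u C₁ C₂ ε' R μ D lam) (k : ℕ) (m : Fin M) (t : Fin T)
    (hD : MemLp (D k m t) 2 μ) :
    ∫⁻ ω, ∫⁻ x, ‖P.noise t ((D k m t ω, P.reparam (u m) (lam k ω)), x)‖ₑ ^ 2
      ∂P.latentAt (D k m t ω, P.reparam (u m) (lam k ω)) ∂μ ≤
    ENNReal.ofReal (4 * (C₁ + K ^ 2 + (C₂ + K ^ 2) * ∫ ω, ‖D k m t ω‖ ^ 2 ∂μ)) := by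
  have := P.latent_prob
  have hDi : Integrable (fun ω => ‖D k m t ω‖ ^ 2) μ := hD.integrable_norm_pow (by simp)
  have hint : Integrable (fun ω => 4 * (C₁ + K ^ 2 + (C₂ + K ^ 2) * ‖D k m t ω‖ ^ 2)) μ :=
    ((integrable_const _).add (hDi.const_mul _)).const_mul _
  have e : 4 * (C₁ + K ^ 2 + (C₂ + K ^ 2) * ∫ ω, ‖D k m t ω‖ ^ 2 ∂μ) =
      ∫ ω, 4 * (C₁ + K ^ 2 + (C₂ + K ^ 2) * ‖D k m t ω‖ ^ 2) ∂μ := by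
    rw [integral_const_mul, integral_add (integrable_const _) (hDi.const_mul _),
      integral_const_mul]
    simp
  rw [e, ofReal_integral_eq_lintegral_ofReal hint (ae_of_all _ fun ω => by positivity)]
  refine lintegral_mono_ae ?_
  filter_upwards [hm.second1 k m, hm.second2 k m] with ω h1 h2
  set θ := P.reparam (u m) (lam k ω)
  set y := D k m t ω
  have hθ := h.lam_mem k ω
  have hG1 : Measurable fun x => P.G1 x (P.obs t) θ :=
    (P.G1_meas t).comp (measurable_id.prodMk measurable_const)
  have hG2 : Measurable fun x => P.G2 x (P.obs t) θ :=
    (P.G2_meas t).comp (measurable_id.prodMk measurable_const)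
  have k1 : ∫⁻ x, ‖P.G1 x (P.obs t) θ‖ₑ ^ 2 ∂P.latent θ ≤ ENNReal.ofReal C₁ :=
    (lintegral_mono fun x => Finset.single_le_sum
      (f := fun t => ‖P.G1 x (P.obs t) θ‖ₑ ^ 2) (fun _ _ => zero_le) (Finset.mem_univ t)).trans h1
  have k2 : ∫⁻ x, ‖P.G2 x (P.obs t) θ‖ₑ ^ 2 ∂P.latent θ ≤ ENNReal.ofReal C₂ :=
    (lintegral_mono fun x => Finset.single_le_sum
      (f := fun t => ‖P.G2 x (P.obs t) θ‖ₑ ^ 2) (fun _ _ => zero_le) (Finset.mem_univ t)).trans h2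
  have hsq : ∀ {F : Type} [NormedAddCommGroup F] (a : F), ‖a‖ₑ ^ 2 = ENNReal.ofReal (‖a‖ ^ 2) :=
    fun a => by rw [← ofReal_norm, ENNReal.ofReal_pow (norm_nonneg _)]
  have hpt : ∀ x, ‖P.noise t ((y, θ), x)‖ₑ ^ 2 ≤ 4 * (‖P.G1 x (P.obs t) θ‖ₑ ^ 2 +
      ‖P.G2 x (P.obs t) θ‖ₑ ^ 2 * ENNReal.ofReal (‖y‖ ^ 2) +
        ENNReal.ofReal (K ^ 2 * (1 + ‖y‖ ^ 2))) := fun x => by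
    have := P.norm_noise_sq_le t (y, θ) x (hb.grad_le m t _ hθ) (hb.lik_le m t _ hθ)
    rw [hsq, hsq, hsq, ← ENNReal.ofReal_mul (by positivity),
      ← ENNReal.ofReal_add (by positivity) (by positivity),
      ← ENNReal.ofReal_add (by positivity) (by positivity),
      show (4 : ENNReal) = ENNReal.ofReal 4 by simp, ← ENNReal.ofReal_mul (by positivity)]
    exact ENNReal.ofReal_le_ofReal this
  change ∫⁻ x, ‖P.noise t ((y, θ), x)‖ₑ ^ 2 ∂P.latent θ ≤ _
  calc _ ≤ ∫⁻ x, 4 * (‖P.G1 x (P.obs t) θ‖ₑ ^ 2 +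
      ‖P.G2 x (P.obs t) θ‖ₑ ^ 2 * ENNReal.ofReal (‖y‖ ^ 2) +
        ENNReal.ofReal (K ^ 2 * (1 + ‖y‖ ^ 2))) ∂P.latent θ := lintegral_mono hpt
    _ = 4 * (∫⁻ x, ‖P.G1 x (P.obs t) θ‖ₑ ^ 2 ∂P.latent θ +
      (∫⁻ x, ‖P.G2 x (P.obs t) θ‖ₑ ^ 2 ∂P.latent θ) * ENNReal.ofReal (‖y‖ ^ 2) +
        ENNReal.ofReal (K ^ 2 * (1 + ‖y‖ ^ 2))) := by
      have g1 : Measurable fun x => ‖P.G1 x (P.obs t) θ‖ₑ ^ 2 := hG1.enorm.pow_const 2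
      have g2 : Measurable fun x => ‖P.G2 x (P.obs t) θ‖ₑ ^ 2 := hG2.enorm.pow_const 2
      rw [lintegral_const_mul _ (by fun_prop), lintegral_add_left (by fun_prop),
        lintegral_add_left g1, lintegral_mul_const _ g2]
      simp
    _ ≤ 4 * (ENNReal.ofReal C₁ + ENNReal.ofReal C₂ * ENNReal.ofReal (‖y‖ ^ 2) +
        ENNReal.ofReal (K ^ 2 * (1 + ‖y‖ ^ 2))) := by gcongr
    _ = _ := by
      rw [← ENNReal.ofReal_mul hC₂.le, ← ENNReal.ofReal_add hC₁.le (by positivity),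
        ← ENNReal.ofReal_add (by positivity) (by positivity),
        show (4 : ENNReal) = ENNReal.ofReal 4 by simp, ← ENNReal.ofReal_mul (by positivity)]
      congr 1
      ring

/-- One step of a tracker with its target frozen. -/
theorem tracker_step (h : IsNMTSRun P u α β μ X D lam) (hreg : P.Regular u) (hunb : P.Unbiased)
    (hb : P.UniformBounds u lamBar KL K ε) (hC₁ : 0 < C₁) (hC₂ : 0 < C₂)
    (hm : MomentBounds P u C₁ C₂ ε' R μ D lam) (hN : 1 ≤ N) (k : ℕ) (hα : 0 ≤ α k)
    (q : Fin M × Fin T) (he : MemLp (trackErr P u D lam k q) 2 μ) :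
    MemLp (fun ω => D (k + 1) q.1 q.2 ω - P.target (u q.1) q.2 (lam k ω)) 2 μ ∧
    ∫ ω, ‖D (k + 1) q.1 q.2 ω - P.target (u q.1) q.2 (lam k ω)‖ ^ 2 ∂μ ≤
      (1 - 2 * ε * α k + K ^ 2 * α k ^ 2) * ∫ ω, ‖trackErr P u D lam k q ω‖ ^ 2 ∂μ +
        α k ^ 2 * (4 * (C₁ + K ^ 2 + (C₂ + K ^ 2) *
          (2 * ∫ ω, ‖trackErr P u D lam k q ω‖ ^ 2 ∂μ + 2 * K ^ 2))) / N := by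
  obtain ⟨m, t⟩ := q
  dsimp only
  set Z : Ω → Vec d × Vec d := fun ω => (D k m t ω, P.reparam (u m) (lam k ω)) with hZ
  have hZm : Measurable Z := (h.D_meas k m t).prodMk (h.measurable_param' hreg k m)
  have hD : MemLp (D k m t) 2 μ := by
    have := he.add (h.memLp_target hreg hb k m t)
    convert this using 1
    ext1 ω
    simp [trackErr]
  have hDi : Integrable (fun ω => ‖D k m t ω‖ ^ 2) μ := hD.integrable_norm_pow (by simp)
  have hei : Integrable (fun ω => ‖trackErr P u D lam k (m, t) ω‖ ^ 2) μ :=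
    he.integrable_norm_pow (by simp)
  have hD2 : ∫ ω, ‖D k m t ω‖ ^ 2 ∂μ ≤
      2 * ∫ ω, ‖trackErr P u D lam k (m, t) ω‖ ^ 2 ∂μ + 2 * K ^ 2 := by
    have : ∫ ω, ‖D k m t ω‖ ^ 2 ∂μ ≤
        ∫ ω, (2 * ‖trackErr P u D lam k (m, t) ω‖ ^ 2 + 2 * K ^ 2) ∂μ := by
      refine integral_mono hDi ((hei.const_mul _).add (integrable_const _)) fun ω => ?_
      have h1 := hb.target_le m t _ (h.lam_mem k ω)
      have h2 : ‖D k m t ω‖ ≤ ‖trackErr P u D lam k (m, t) ω‖ + K := by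
        have e : D k m t ω = trackErr P u D lam k (m, t) ω + P.target (u m) t (lam k ω) := by
          simp [trackErr]
        rw [e]
        exact (norm_add_le _ _).trans (by gcongr)
      have := pow_le_pow_left₀ (norm_nonneg _) h2 2
      dsimp only
      nlinarith [sq_nonneg (‖trackErr P u D lam k (m, t) ω‖ - K)]
    rwa [integral_add (hei.const_mul _) (integrable_const _), integral_const_mul,
      integral_const, probReal_univ, one_smul] at this
  have hdrift : ∀ ω, P.drift t (α k) (Z ω) =
      (1 - α k * P.lik (P.obs t) (P.reparam (u m) (lam k ω))) • trackErr P u D lam k (m, t) ω :=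
    fun ω => rfl
  -- Expand the square and use `ε ≤ p ≤ K`.
  have hcoef : ∀ ω, (1 - α k * P.lik (P.obs t) (P.reparam (u m) (lam k ω))) ^ 2 ≤
      1 - 2 * ε * α k + K ^ 2 * α k ^ 2 := fun ω => by
    have h1 := hb.lik_ge m t _ (h.lam_mem k ω)
    have h2 := hb.lik_le m t _ (h.lam_mem k ω)
    rw [Real.norm_of_nonneg (P.lik_nonneg _ _)] at h2
    have h3 := pow_le_pow_left₀ (P.lik_nonneg _ _) h2 2
    have h4 := mul_le_mul_of_nonneg_left h1 hα
    have h5 := mul_le_mul_of_nonneg_left h3 (sq_nonneg (α k))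
    nlinarith
  have hdsq : ∀ ω, ‖P.drift t (α k) (Z ω)‖ ^ 2 ≤ (1 - 2 * ε * α k + K ^ 2 * α k ^ 2) *
      ‖trackErr P u D lam k (m, t) ω‖ ^ 2 := fun ω => by
    rw [hdrift, norm_smul, mul_pow, Real.norm_eq_abs, sq_abs]
    exact mul_le_mul_of_nonneg_right (hcoef ω) (by positivity)
  have hdm : AEStronglyMeasurable (fun ω => P.drift t (α k) (Z ω)) μ :=
    ((hreg.measurable_drift t (α k)).comp hZm).aestronglyMeasurable
  have hdi : Integrable (fun ω => ‖P.drift t (α k) (Z ω)‖ ^ 2) μ :=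
    (hei.const_mul _).mono' (hdm.norm.pow 2)
      (ae_of_all _ fun ω => by rw [Real.norm_of_nonneg (by positivity)]; exact hdsq ω)
  have hd2 : MemLp (fun ω => P.drift t (α k) (Z ω)) 2 μ :=
    (memLp_two_iff_integrable_sq_norm hdm).2 hdi
  have hid : ∀ ω, P.drift t (α k) (Z ω) +
      α k • ((N : ℝ)⁻¹ • ∑ i, P.noise t (Z ω, X k m i ω)) =
      D (k + 1) m t ω - P.target (u m) t (lam k ω) := fun ω => by
    rw [P.drift_add_noise t (α k) hN (Z ω) (fun i => X k m i ω) (hreg.lik_pos t _), h.fast]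
    rfl
  have hv : 0 ≤ 4 * (C₁ + K ^ 2 + (C₂ + K ^ 2) * ∫ ω, ‖D k m t ω‖ ^ 2 ∂μ) := by
    have : 0 ≤ ∫ ω, ‖D k m t ω‖ ^ 2 ∂μ := integral_nonneg fun ω => by positivity
    positivity
  have key := CondSample.secondMoment (Z := Z) (h.condSample hreg k m t) hZm (h.X_meas k m) hN
    (hreg.measurable_drift t (α k)) (hreg.measurable_noise t) (hunb.integrable_noise t)
    (hunb.integral_noise t) hd2 hv (h.lintegral_noise_le hb hC₁ hC₂ hm k m t hD) (α k)
  simp_rw [hid] at key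
  refine ⟨key.1, key.2.trans (add_le_add ?_ ?_)⟩
  · rw [← integral_const_mul]
    exact integral_mono hdi (hei.const_mul _) hdsq
  · gcongr

end IsNMTSRun

end Run

/-! ### Recursions along a run and the convergence rate -/

section RunRates

variable {P : PosteriorProblem 𝒳 𝒴 𝒰 d l T} {u : Fin M → 𝒰} {α β : ℕ → ℝ}
  {Ω : Type w} [MeasurableSpace Ω] {μ : Measure Ω} {X : ℕ → Fin M → Fin N → Ω → 𝒳}
  {D : ℕ → Fin M → Fin T → Ω → Vec d} {lam : ℕ → Ω → Vec l}

/-- Young's inequality; the excess is at least `(η ‖x‖ - ‖y‖)² / η`. -/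
theorem norm_add_sq_le_of_pos {E : Type*} [SeminormedAddCommGroup E] (x y : E) {η : ℝ}
    (hη : 0 < η) : ‖x + y‖ ^ 2 ≤ (1 + η) * ‖x‖ ^ 2 + (1 + 1 / η) * ‖y‖ ^ 2 := by
  have h1 := pow_le_pow_left₀ (norm_nonneg _) (norm_add_le x y) 2
  have h2 : 0 ≤ (η * ‖x‖ - ‖y‖) ^ 2 / η := by positivity
  have h3 : (η * ‖x‖ - ‖y‖) ^ 2 / η = η * ‖x‖ ^ 2 - 2 * (‖x‖ * ‖y‖) + 1 / η * ‖y‖ ^ 2 := by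
    field_simp
    ring
  nlinarith

/-- Nonnegativity of the variance of `‖f‖`. -/
theorem integral_norm_le_sqrt {E : Type*} [NormedAddCommGroup E] [IsProbabilityMeasure μ]
    {f : Ω → E} (hf : MemLp f 2 μ) : ∫ ω, ‖f ω‖ ∂μ ≤ √(∫ ω, ‖f ω‖ ^ 2 ∂μ) := by
  refine Real.le_sqrt_of_sq_le ?_
  have h1 := variance_nonneg (fun ω => ‖f ω‖) μ
  rw [variance_eq_sub hf.norm] at h1
  simpa using h1

namespace IsNMTSRun

variable {lamBar : Vec l} {KL K ε C₁ C₂ ε' R : ℝ}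

theorem norm_slow_sub_le (h : IsNMTSRun P u α β μ X D lam) (hreg : P.Regular u) (k : ℕ) (ω : Ω)
    {z : Vec l} (hz : z ∈ P.feasible) : ‖lam (k + 1) ω - z‖ ≤
      ‖lam k ω + β k • P.slowDir u (fun m t => D k m t ω) (lam k ω) - z‖ :=
  (h.slow k ω).norm_sub_le hreg.convex hz

theorem norm_slowDir_sub_le (h : IsNMTSRun P u α β μ X D lam)
    (hb : P.UniformBounds u lamBar KL K ε) (k : ℕ) (ω : Ω) :
    ‖P.slowDir u (fun m t => D k m t ω) (lam k ω) - P.saaGrad u (lam k ω)‖ ≤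
      K * ∑ q, ‖trackErr P u D lam k q ω‖ := by
  rw [Fintype.sum_prod_type]
  exact hb.norm_slowDir_sub_le _ (h.lam_mem k ω)

/-- The squared drift of a target during one slow step. -/
theorem norm_target_sub_sq_le (h : IsNMTSRun P u α β μ X D lam) (hreg : P.Regular u)
    (hb : P.UniformBounds u lamBar KL K ε) (k : ℕ) (hβ : 0 ≤ β k) (q : Fin M × Fin T) (ω : Ω) :
    ‖P.target (u q.1) q.2 (lam k ω) - P.target (u q.1) q.2 (lam (k + 1) ω)‖ ^ 2 ≤
      2 * K ^ 4 * β k ^ 2 *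
        (1 + (M * T : ℕ) * ∑ q, ‖trackErr P u D lam k q ω‖ ^ 2) := by
  have hK : 0 ≤ K := zero_le_one.trans hb.one_le
  set S := ∑ q, ‖trackErr P u D lam k q ω‖ with hS
  have hS0 : 0 ≤ S := Finset.sum_nonneg fun _ _ => norm_nonneg _
  -- Comparison with the feasible point `lam k ω` itself: projecting cannot lengthen the step.
  have h1 := h.norm_slow_sub_le hreg k ω (h.lam_mem k ω)
  rw [add_sub_cancel_left, norm_smul, Real.norm_of_nonneg hβ] at h1
  have h2 : ‖P.slowDir u (fun m t => D k m t ω) (lam k ω)‖ ≤ K * (1 + S) := by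
    have e := norm_le_norm_add_norm_sub' (P.slowDir u (fun m t => D k m t ω) (lam k ω))
      (P.saaGrad u (lam k ω))
    have := h.norm_slowDir_sub_le hb k ω
    have := hb.saaGrad_le _ (h.lam_mem k ω)
    linarith
  have h3 := hb.target_lip q.1 q.2 _ (h.lam_mem k ω) _ (h.lam_mem (k + 1) ω)
  rw [norm_sub_rev (lam k ω)] at h3
  have h4 : ‖P.target (u q.1) q.2 (lam k ω) - P.target (u q.1) q.2 (lam (k + 1) ω)‖ ≤
      K * (β k * (K * (1 + S))) :=
    h3.trans (mul_le_mul_of_nonneg_left (h1.trans (mul_le_mul_of_nonneg_left h2 hβ)) hK)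
  have h5 := pow_le_pow_left₀ (norm_nonneg _) h4 2
  have h6 : S ^ 2 ≤ (M * T : ℕ) * ∑ q, ‖trackErr P u D lam k q ω‖ ^ 2 := by
    simpa [Fintype.card_prod] using sq_sum_le_card_mul_sum_sq (s := Finset.univ)
      (f := fun q => ‖trackErr P u D lam k q ω‖)
  have h7 : (1 + S) ^ 2 ≤ 2 * (1 + (M * T : ℕ) * ∑ q, ‖trackErr P u D lam k q ω‖ ^ 2) := by
    nlinarith [sq_nonneg (1 - S)]
  have h8 := mul_le_mul_of_nonneg_left h7 (by positivity : 0 ≤ K ^ 4 * β k ^ 2)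
  nlinarith

theorem memLp_zero (h : IsNMTSRun P u α β μ X D lam)
    (hm : MomentBounds P u C₁ C₂ ε' R μ D lam) (q : Fin M × Fin T) :
    MemLp (D 0 q.1 q.2) 2 μ := by
  refine ⟨(h.D_meas 0 q.1 q.2).aestronglyMeasurable, ?_⟩
  rw [eLpNorm_lt_top_iff_lintegral_rpow_enorm_lt_top (by simp) (by simp)]
  refine lt_of_le_of_lt (lintegral_mono fun ω => ?_)
    (hm.initial.trans_lt ENNReal.ofReal_lt_top)
  have h1 := Finset.single_le_sum (f := fun t => ‖D 0 q.1 t ω‖ₑ ^ 2) (fun _ _ => zero_le)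
    (Finset.mem_univ q.2)
  have h2 := Finset.single_le_sum (f := fun m => ∑ t, ‖D 0 m t ω‖ₑ ^ 2) (fun _ _ => zero_le)
    (Finset.mem_univ q.1)
  simpa using h1.trans h2

variable [IsProbabilityMeasure μ]

/-- Without square integrability the Bochner integrals in `trackMSE` would default to `0` and bound
nothing. -/
theorem memLp_trackErr (h : IsNMTSRun P u α β μ X D lam) (hreg : P.Regular u)
    (hunb : P.Unbiased) (hb : P.UniformBounds u lamBar KL K ε) (hC₁ : 0 < C₁) (hC₂ : 0 < C₂)
    (hm : MomentBounds P u C₁ C₂ ε' R μ D lam) (hN : 1 ≤ N) (hα : ∀ k, 0 ≤ α k) (k : ℕ)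
    (q : Fin M × Fin T) : MemLp (trackErr P u D lam k q) 2 μ := by
  induction k with
  | zero =>
    exact (h.memLp_zero hm q).sub (h.memLp_target hreg hb 0 q.1 q.2)
  | succ k ih =>
    have h1 := (h.tracker_step hreg hunb hb hC₁ hC₂ hm hN k (hα k) q ih).1
    have h2 := (h1.add (h.memLp_target hreg hb k q.1 q.2)).sub
      (h.memLp_target hreg hb (k + 1) q.1 q.2)
    refine h2.ae_eq (ae_of_all _ fun ω => ?_)
    simp [trackErr]

/-- The recursion for the total mean square error of the trackers. -/
theorem trackMSE_succ_le (h : IsNMTSRun P u α β μ X D lam) (hreg : P.Regular u)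
    (hunb : P.Unbiased) (hb : P.UniformBounds u lamBar KL K ε) (hC₁ : 0 < C₁) (hC₂ : 0 < C₂)
    (hm : MomentBounds P u C₁ C₂ ε' R μ D lam) (hN : 1 ≤ N) (hα : ∀ k, 0 ≤ α k)
    (hβ : ∀ k, 0 ≤ β k) (k : ℕ) {η : ℝ} (hη : 0 < η) {n : ℝ} (hn : n = (M * T : ℕ)) :
    trackMSE P u μ D lam (k + 1) ≤
      (1 + η) * ((1 - 2 * ε * α k + (K ^ 2 + 8 * (C₂ + K ^ 2)) * α k ^ 2) * trackMSE P u μ D lam k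
        + n * (4 * (C₁ + K ^ 2) + 8 * (C₂ + K ^ 2) * K ^ 2) * α k ^ 2 / N) +
      (1 + 1 / η) * (n * (2 * K ^ 4) * β k ^ 2 * (1 + n * trackMSE P u μ D lam k)) := by
  have he := h.memLp_trackErr hreg hunb hb hC₁ hC₂ hm hN hα
  have hei : ∀ k q, Integrable (fun ω => ‖trackErr P u D lam k q ω‖ ^ 2) μ := fun k q =>
    (he k q).integrable_norm_pow (by simp)
  set V := trackMSE P u μ D lam k with hV
  have hVsum : ∫ ω, ∑ q, ‖trackErr P u D lam k q ω‖ ^ 2 ∂μ = V :=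
    integral_finsetSum _ fun q _ => hei k q
  have hNpos : (1 : ℝ) ≤ N := by exact_mod_cast hN
  have hq : ∀ q, ∫ ω, ‖trackErr P u D lam (k + 1) q ω‖ ^ 2 ∂μ ≤
      (1 + η) * ((1 - 2 * ε * α k + K ^ 2 * α k ^ 2) *
          ∫ ω, ‖trackErr P u D lam k q ω‖ ^ 2 ∂μ +
        α k ^ 2 * (4 * (C₁ + K ^ 2 + (C₂ + K ^ 2) *
          (2 * ∫ ω, ‖trackErr P u D lam k q ω‖ ^ 2 ∂μ + 2 * K ^ 2))) / N) +
      (1 + 1 / η) * (2 * K ^ 4 * β k ^ 2 * (1 + n * V)) := fun q => by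
    obtain ⟨h1, h2⟩ := h.tracker_step hreg hunb hb hC₁ hC₂ hm hN k (hα k) q (he k q)
    have h1i : Integrable
        (fun ω => ‖D (k + 1) q.1 q.2 ω - P.target (u q.1) q.2 (lam k ω)‖ ^ 2) μ :=
      h1.integrable_norm_pow (by simp)
    have hSi : Integrable (fun ω => ∑ q, ‖trackErr P u D lam k q ω‖ ^ 2) μ :=
      integrable_finsetSum _ fun q _ => hei k q
    have hri : Integrable (fun ω => 2 * K ^ 4 * β k ^ 2 *
        (1 + n * ∑ q, ‖trackErr P u D lam k q ω‖ ^ 2)) μ :=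
      ((integrable_const _).add (hSi.const_mul _)).const_mul _
    have h3 : ∫ ω, ‖trackErr P u D lam (k + 1) q ω‖ ^ 2 ∂μ ≤
        ∫ ω, ((1 + η) * ‖D (k + 1) q.1 q.2 ω - P.target (u q.1) q.2 (lam k ω)‖ ^ 2 +
          (1 + 1 / η) * (2 * K ^ 4 * β k ^ 2 *
            (1 + n * ∑ q, ‖trackErr P u D lam k q ω‖ ^ 2))) ∂μ := by
      refine integral_mono (hei (k + 1) q) ((h1i.const_mul _).add (hri.const_mul _)) fun ω => ?_
      have e : trackErr P u D lam (k + 1) q ω =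
          (D (k + 1) q.1 q.2 ω - P.target (u q.1) q.2 (lam k ω)) +
          (P.target (u q.1) q.2 (lam k ω) - P.target (u q.1) q.2 (lam (k + 1) ω)) := by
        simp [trackErr]
      have h4 := h.norm_target_sub_sq_le hreg hb k (hβ k) q ω
      rw [← hn] at h4
      have h5 := norm_add_sq_le_of_pos
        (D (k + 1) q.1 q.2 ω - P.target (u q.1) q.2 (lam k ω))
        (P.target (u q.1) q.2 (lam k ω) - P.target (u q.1) q.2 (lam (k + 1) ω)) hη
      rw [← e] at h5
      exact h5.trans (add_le_add_right (mul_le_mul_of_nonneg_left h4 (by positivity)) _)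
    rw [integral_add (h1i.const_mul _) (hri.const_mul _), integral_const_mul,
      integral_const_mul, integral_const_mul, integral_add (integrable_const _)
      (hSi.const_mul _), integral_const_mul, hVsum, integral_const, probReal_univ,
      one_smul] at h3
    exact h3.trans (add_le_add_left (mul_le_mul_of_nonneg_left h2 (by positivity)) _)
  have hsum := Finset.sum_le_sum fun q (_ : q ∈ Finset.univ) => hq q
  have hcard : ((Finset.univ : Finset (Fin M × Fin T)).card : ℝ) = n := by
    simp [hn, Fintype.card_prod]
  have e : ∑ q : Fin M × Fin T, ((1 + η) * ((1 - 2 * ε * α k + K ^ 2 * α k ^ 2) *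
          ∫ ω, ‖trackErr P u D lam k q ω‖ ^ 2 ∂μ +
        α k ^ 2 * (4 * (C₁ + K ^ 2 + (C₂ + K ^ 2) *
          (2 * ∫ ω, ‖trackErr P u D lam k q ω‖ ^ 2 ∂μ + 2 * K ^ 2))) / N) +
      (1 + 1 / η) * (2 * K ^ 4 * β k ^ 2 * (1 + n * V))) =
      (1 + η) * ((1 - 2 * ε * α k + K ^ 2 * α k ^ 2) * V +
        α k ^ 2 * (4 * (n * (C₁ + K ^ 2) + (C₂ + K ^ 2) * (2 * V + n * (2 * K ^ 2)))) / N) +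
      n * ((1 + 1 / η) * (2 * K ^ 4 * β k ^ 2 * (1 + n * V))) := by
    simp only [Finset.sum_add_distrib, ← Finset.mul_sum, ← Finset.sum_div, Finset.sum_const,
      nsmul_eq_mul, hcard]
    rw [show ∑ q, ∫ ω, ‖trackErr P u D lam k q ω‖ ^ 2 ∂μ = V from rfl]
    ring
  rw [e] at hsum
  have hV0 : 0 ≤ V := trackMSE_nonneg k
  -- The part of the noise proportional to `V` may lose its `1 / N`, since it only perturbs the
  -- contraction at order `α²`. The constant part must keep it.
  have hdiv : α k ^ 2 * (8 * (C₂ + K ^ 2) * V) / N ≤ α k ^ 2 * (8 * (C₂ + K ^ 2) * V) :=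
    div_le_self (by positivity) hNpos
  refine hsum.trans ?_
  have e2 : α k ^ 2 * (4 * (n * (C₁ + K ^ 2) + (C₂ + K ^ 2) * (2 * V + n * (2 * K ^ 2)))) / N =
      α k ^ 2 * (8 * (C₂ + K ^ 2) * V) / N +
        n * (4 * (C₁ + K ^ 2) + 8 * (C₂ + K ^ 2) * K ^ 2) * α k ^ 2 / N := by ring
  rw [e2]
  have h6 := mul_le_mul_of_nonneg_left hdiv (by positivity : 0 ≤ 1 + η)
  nlinarith

theorem trackMSE_zero_le (h : IsNMTSRun P u α β μ X D lam) (hreg : P.Regular u)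
    (hb : P.UniformBounds u lamBar KL K ε) (hR : 0 ≤ R)
    (hm : MomentBounds P u C₁ C₂ ε' R μ D lam) :
    trackMSE P u μ D lam 0 ≤ 2 * R + (M * T : ℕ) * (2 * K ^ 2) := by
  have hD2 : ∀ q : Fin M × Fin T, MemLp (D 0 q.1 q.2) 2 μ := h.memLp_zero hm
  have hDi : ∀ q : Fin M × Fin T, Integrable (fun ω => ‖D 0 q.1 q.2 ω‖ ^ 2) μ := fun q =>
    (hD2 q).integrable_norm_pow (by simp)
  have h1 : ∑ q : Fin M × Fin T, ∫ ω, ‖D 0 q.1 q.2 ω‖ ^ 2 ∂μ ≤ R := by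
    rw [← integral_finsetSum _ fun q _ => hDi q, integral_eq_lintegral_of_nonneg_ae
      (ae_of_all _ fun ω => Finset.sum_nonneg fun _ _ => by positivity)
      (integrable_finsetSum _ fun q _ => hDi q).1]
    refine ENNReal.toReal_le_of_le_ofReal hR (hm.initial.trans' (lintegral_mono fun ω => ?_))
    rw [ENNReal.ofReal_sum_of_nonneg fun _ _ => by positivity, Fintype.sum_prod_type]
    refine Finset.sum_le_sum fun m _ => Finset.sum_le_sum fun t _ => ?_
    rw [← ofReal_norm, ENNReal.ofReal_pow (norm_nonneg _)]
  have h2 : ∀ q, ∫ ω, ‖trackErr P u D lam 0 q ω‖ ^ 2 ∂μ ≤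
      2 * ∫ ω, ‖D 0 q.1 q.2 ω‖ ^ 2 ∂μ + 2 * K ^ 2 := fun q => by
    have : ∫ ω, ‖trackErr P u D lam 0 q ω‖ ^ 2 ∂μ ≤
        ∫ ω, (2 * ‖D 0 q.1 q.2 ω‖ ^ 2 + 2 * K ^ 2) ∂μ := by
      refine integral_mono (((hD2 q).sub (h.memLp_target hreg hb 0 q.1 q.2)).integrable_norm_pow
        (by simp)) (((hDi q).const_mul _).add (integrable_const _)) fun ω => ?_
      have h3 := (norm_sub_le (D 0 q.1 q.2 ω) (P.target (u q.1) q.2 (lam 0 ω))).trans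
        (add_le_add_right (hb.target_le q.1 q.2 _ (h.lam_mem 0 ω)) _)
      have h4 := pow_le_pow_left₀ (norm_nonneg _) h3 2
      simp only [trackErr]
      nlinarith [sq_nonneg (‖D 0 q.1 q.2 ω‖ - K)]
    rwa [integral_add ((hDi q).const_mul _) (integrable_const _), integral_const_mul,
      integral_const, probReal_univ, one_smul] at this
  refine (Finset.sum_le_sum fun q _ => h2 q).trans ?_
  rw [Finset.sum_add_distrib, ← Finset.mul_sum, Finset.sum_const, nsmul_eq_mul, Finset.card_univ,
    Fintype.card_prod, Fintype.card_fin, Fintype.card_fin]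
  linarith

theorem integrable_norm_sub (h : IsNMTSRun P u α β μ X D lam)
    (hb : P.UniformBounds u lamBar KL K ε) (k : ℕ) :
    Integrable (fun ω => ‖lam k ω - lamBar‖) μ :=
  Integrable.of_bound ((h.lam_meas k).sub_const _).norm.aestronglyMeasurable K
    (ae_of_all _ fun ω => by simpa using hb.sub_le _ (h.lam_mem k ω))

theorem integral_norm_sub_le (h : IsNMTSRun P u α β μ X D lam)
    (hb : P.UniformBounds u lamBar KL K ε) (k : ℕ) : ∫ ω, ‖lam k ω - lamBar‖ ∂μ ≤ K := by
  have := integral_mono (h.integrable_norm_sub hb k) (integrable_const K)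
    fun ω => hb.sub_le _ (h.lam_mem k ω)
  simpa using this

/-- The recursion for the mean error of the slow iterate. -/
theorem integral_norm_sub_succ_le (h : IsNMTSRun P u α β μ X D lam) (hreg : P.Regular u)
    (hb : P.UniformBounds u lamBar KL K ε) (hmem : lamBar ∈ P.feasible) (k : ℕ)
    (he : ∀ q, MemLp (trackErr P u D lam k q) 2 μ) (hβ : 0 ≤ β k) (hβK : β k * KL ≤ 1) :
    ∫ ω, ‖lam (k + 1) ω - lamBar‖ ∂μ ≤
      (1 - KL * β k + K ^ 2 * β k ^ 2) * ∫ ω, ‖lam k ω - lamBar‖ ∂μ +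
        β k * (K * ((M * T : ℕ) * √(trackMSE P u μ D lam k))) := by
  have hK : 0 ≤ K := zero_le_one.trans hb.one_le
  have hni : ∀ q, Integrable (fun ω => ‖trackErr P u D lam k q ω‖) μ := fun q =>
    ((he q).integrable (by norm_num)).norm
  have hSi : Integrable (fun ω => ∑ q, ‖trackErr P u D lam k q ω‖) μ :=
    integrable_finsetSum _ fun q _ => hni q
  have h1 : ∫ ω, ‖lam (k + 1) ω - lamBar‖ ∂μ ≤
      ∫ ω, ((1 - KL * β k + K ^ 2 * β k ^ 2) * ‖lam k ω - lamBar‖ +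
        β k * (K * ∑ q, ‖trackErr P u D lam k q ω‖)) ∂μ := by
    refine integral_mono (h.integrable_norm_sub hb (k + 1))
      (((h.integrable_norm_sub hb k).const_mul _).add ((hSi.const_mul _).const_mul _))
      fun ω => (h.norm_slow_sub_le hreg k ω hmem).trans ?_
    set s := P.slowDir u (fun m t => D k m t ω) (lam k ω) with hs
    -- An exact gradient step plus the tracking error; the latter is bounded in norm only.
    have e : lam k ω + β k • s - lamBar = (lam k ω + β k • P.saaGrad u (lam k ω) - lamBar) +
        β k • (s - P.saaGrad u (lam k ω)) := by module
    rw [e]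
    refine (norm_add_le _ _).trans (add_le_add
      (hb.norm_gradientStep_le hβ hβK (h.lam_mem k ω)) ?_)
    rw [norm_smul, Real.norm_of_nonneg hβ]
    exact mul_le_mul_of_nonneg_left (h.norm_slowDir_sub_le hb k ω) hβ
  rw [integral_add ((h.integrable_norm_sub hb k).const_mul _) ((hSi.const_mul _).const_mul _),
    integral_const_mul, integral_const_mul, integral_const_mul,
    integral_finsetSum _ fun q _ => hni q] at h1
  refine h1.trans ?_
  have h2 : ∑ q, ∫ ω, ‖trackErr P u D lam k q ω‖ ∂μ ≤
      (M * T : ℕ) * √(trackMSE P u μ D lam k) := by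
    have h3 : ∀ q ∈ Finset.univ, ∫ ω, ‖trackErr P u D lam k q ω‖ ∂μ ≤
        √(trackMSE P u μ D lam k) := fun q hq => (integral_norm_le_sqrt (he q)).trans
      (Real.sqrt_le_sqrt (Finset.single_le_sum
        (f := fun q => ∫ ω, ‖trackErr P u D lam k q ω‖ ^ 2 ∂μ)
        (fun _ _ => integral_nonneg fun _ => by positivity) hq))
    simpa [Fintype.card_prod] using Finset.sum_le_card_nsmul _ _ _ h3
  gcongr

end IsNMTSRun

/-- The convergence rate of the slow iterates, uniformly over all runs and batch sizes. -/
theorem exists_rate_const {a b α₀ β₀ : ℝ} (hstep : StepSizes a b α₀ β₀ α β)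
    (P : PosteriorProblem 𝒳 𝒴 𝒰 d l T) (u : Fin M → 𝒰)
    (hreg : P.Regular u) (hunb : P.Unbiased)
    (lamBar : Vec l) (hint : lamBar ∈ interior P.feasible) (hzero : P.saaGrad u lamBar = 0)
    (KL : ℝ) (hKL : 0 < KL)
    (hcurv : ∀ lam ∈ P.feasible, ∀ v : Vec l,
      inner ℝ v (fderivWithin ℝ (P.saaGrad u) P.feasible lam v) ≤ -KL * ‖v‖ ^ 2)
    (hb_one : b = 1 → max (1 - a) (a / 2) < β₀ * KL)
    (C₁ C₂ ε R : ℝ) (hC₁ : 0 < C₁) (hC₂ : 0 < C₂) (hR : 0 ≤ R) :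
    ∃ c : ℝ, 0 ≤ c ∧
      ∀ (N : ℕ), 1 ≤ N → ∀ (Ω : Type w) [MeasurableSpace Ω] (μ : Measure Ω)
        [IsProbabilityMeasure μ] (X : ℕ → Fin M → Fin N → Ω → 𝒳)
        (D : ℕ → Fin M → Fin T → Ω → Vec d) (lam : ℕ → Ω → Vec l),
        IsNMTSRun P u α β μ X D lam → MomentBounds P u C₁ C₂ ε R μ D lam →
        ∀ k : ℕ, 1 ≤ k →
          ∫ ω, ‖lam k ω - lamBar‖ ∂μ ≤ c * (β k / α k + √(α k / N)) := by
  obtain ⟨K, ε₀, hε₀, hb⟩ := hreg.exists_uniformBounds hint hzero hcurv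
  have hK : 0 ≤ K := zero_le_one.trans hb.one_le
  set n : ℝ := ((M * T : ℕ) : ℝ) with hn
  have hn0 : 0 ≤ n := Nat.cast_nonneg _
  set A₁ := K ^ 2 + 8 * (C₂ + K ^ 2) with hA₁
  set A₂ := n * (4 * (C₁ + K ^ 2) + 8 * (C₂ + K ^ 2) * K ^ 2) with hA₂
  set A₃ := n * (2 * K ^ 4) with hA₃
  have h₁ : 0 ≤ A₁ := by positivity
  have h₂ : 0 ≤ A₂ := by positivity
  have h₃ : 0 ≤ A₃ := by positivity
  -- One constant for all three terms of the fast recursion, fixed before `N` and the run. The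
  -- factor `1 + n` absorbs the `n` in `1 + n V`.
  set C := A₁ + A₂ + A₃ * (1 + n) with hC
  obtain ⟨Cf, hCf, hfast⟩ := hstep.exists_fast_rate (ε := ε₀) (C := C)
    (R := 2 * R + n * (2 * K ^ 2)) hε₀ (by positivity)
  obtain ⟨Cs, hCs, hslow⟩ := hstep.exists_slow_rate (KL := KL)
    (C := K ^ 2 + K * (n * √Cf)) (B := K) hKL hb_one
  refine ⟨Cs, hCs, fun N hN Ω _ μ _ X D lam hrun hmom => ?_⟩
  have hα := fun k => (hstep.α_pos k).le
  have hβ := fun k => (hstep.β_pos k).le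
  have he := hrun.memLp_trackErr hreg hunb hb hC₁ hC₂ hmom hN hα
  have hV0 : ∀ k, 0 ≤ trackMSE P u μ D lam k := trackMSE_nonneg
  have hV := hfast N hN (trackMSE P u μ D lam) hV0 (hrun.trackMSE_zero_le hreg hb hR hmom)
    fun k η hη => by
      refine (hrun.trackMSE_succ_le hreg hunb hb hC₁ hC₂ hmom hN hα hβ k hη hn).trans ?_
      have g0 := hV0 k
      have g1 : A₁ ≤ C := by
        have : 0 ≤ A₃ * (1 + n) := by positivity
        linarith
      have g2 : A₂ ≤ C := by
        have : 0 ≤ A₃ * (1 + n) := by positivity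
        linarith
      have g3 : A₃ * β k ^ 2 * (1 + n * trackMSE P u μ D lam k) ≤
          C * β k ^ 2 * (1 + trackMSE P u μ D lam k) := by
        have g4 : A₃ * (1 + n * trackMSE P u μ D lam k) ≤
            C * (1 + trackMSE P u μ D lam k) := by
          have g5 : 1 + n * trackMSE P u μ D lam k ≤
              (1 + n) * (1 + trackMSE P u μ D lam k) := by nlinarith
          calc _ ≤ A₃ * ((1 + n) * (1 + trackMSE P u μ D lam k)) :=
                mul_le_mul_of_nonneg_left g5 h₃
            _ = A₃ * (1 + n) * (1 + trackMSE P u μ D lam k) := by ring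
            _ ≤ _ := mul_le_mul_of_nonneg_right (by linarith) (by linarith)
        have := mul_le_mul_of_nonneg_right g4 (sq_nonneg (β k))
        linarith
      gcongr
  refine hslow N hN (fun k => ∫ ω, ‖lam k ω - lamBar‖ ∂μ)
    (fun k => integral_nonneg fun _ => norm_nonneg _) (hrun.integral_norm_sub_le hb)
    fun k hk hβK => ?_
  refine (hrun.integral_norm_sub_succ_le hreg hb (interior_subset hint) k (he k) (hβ k)
    hβK).trans ?_
  have hW : 0 ≤ ∫ ω, ‖lam k ω - lamBar‖ ∂μ := integral_nonneg fun _ => norm_nonneg _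
  have hr : 0 ≤ β k / α k := div_nonneg (hβ k) (hα k)
  have hs : 0 ≤ √(α k / N) := Real.sqrt_nonneg _
  -- This rests on `√(x² + y²) ≤ x + y` for nonnegative `x` and `y`.
  have hsq : √(trackMSE P u μ D lam k) ≤ √Cf * (β k / α k + √(α k / N)) := by
    refine (Real.sqrt_le_sqrt (hV k hk)).trans ?_
    rw [Real.sqrt_mul hCf]
    refine mul_le_mul_of_nonneg_left (Real.sqrt_le_iff.2 ⟨by positivity, ?_⟩) (Real.sqrt_nonneg _)
    have := Real.sq_sqrt (div_nonneg (hα k) (Nat.cast_nonneg N))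
    nlinarith [mul_nonneg hr hs]
  set s := β k / α k + √(α k / N)
  have hs0 : 0 ≤ s := add_nonneg hr hs
  have q1 : K ^ 2 * β k ^ 2 ≤ (K ^ 2 + K * (n * √Cf)) * β k ^ 2 :=
    mul_le_mul_of_nonneg_right (le_add_of_nonneg_right (by positivity)) (sq_nonneg _)
  have q2 : β k * (K * (n * √(trackMSE P u μ D lam k))) ≤
      (K ^ 2 + K * (n * √Cf)) * β k * s := by
    have : β k * (K * (n * √(trackMSE P u μ D lam k))) ≤ β k * (K * (n * (√Cf * s))) := by
      have := hβ k
      gcongr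
    have : 0 ≤ K ^ 2 * β k * s := mul_nonneg (mul_nonneg (by positivity) (hβ k)) hs0
    linarith
  exact add_le_add (mul_le_mul_of_nonneg_right (by linarith) hW) q2

end RunRates

end

theorem theorem4 {𝒳 : Type u₁} {𝒴 : Type u₂} {𝒰 : Type u₃}
    [MeasurableSpace 𝒳] [MeasurableSpace 𝒴] [MeasurableSpace 𝒰] {d l T M : ℕ} (hM : 1 ≤ M)
    (P : PosteriorProblem 𝒳 𝒴 𝒰 d l T) (u : Fin M → 𝒰)
    (hreg : P.Regular u) (hunb : P.Unbiased)
    -- the maximizer of the sample-average problem, in the interior of the feasible region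
    (lamBar : Vec l) (hint : lamBar ∈ interior P.feasible) (hzero : P.saaGrad u lamBar = 0)
    -- uniform negative definiteness of the sample-average Hessian
    (KL : ℝ) (hKL : 0 < KL)
    (hcurv : ∀ lam ∈ P.feasible, ∀ v : Vec l,
      inner ℝ v (fderivWithin ℝ (P.saaGrad u) P.feasible lam v) ≤ -KL * ‖v‖ ^ 2)
    -- polynomial step sizes
    (a b α₀ β₀ : ℝ) (ha : 1 / 2 < a) (hab : a < b) (hb : b ≤ 1) (hα₀ : 0 < α₀) (hβ₀ : 0 < β₀)
    (α β : ℕ → ℝ) (hα_zero : 0 < α 0) (hβ_zero : 0 < β 0)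
    (hα : ∀ k : ℕ, 1 ≤ k → α k = α₀ / (k : ℝ) ^ a)
    (hβ : ∀ k : ℕ, 1 ≤ k → β k = β₀ / (k : ℝ) ^ b)
    (hb_one : b = 1 → max (1 - a) (a / 2) < β₀ * KL)
    -- the constants of the moment assumptions
    (C₁ C₂ ε R : ℝ) (hC₁ : 0 < C₁) (hC₂ : 0 < C₂) (hε : 0 < ε) (hR : 0 ≤ R) :
    -- the rate, with constants that depend neither on `N` nor on `k`
    (∃ c₁ c₂ : ℝ, 0 ≤ c₁ ∧ 0 ≤ c₂ ∧
      ∀ (N : ℕ), 1 ≤ N → ∀ (Ω : Type w) [MeasurableSpace Ω] (μ : Measure Ω)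
        [IsProbabilityMeasure μ] (X : ℕ → Fin M → Fin N → Ω → 𝒳)
        (D : ℕ → Fin M → Fin T → Ω → Vec d) (lam : ℕ → Ω → Vec l),
        IsNMTSRun P u α β μ X D lam → MomentBounds P u C₁ C₂ ε R μ D lam →
        ∀ k : ℕ, 1 ≤ k →
          ∫ ω, ‖lam k ω - lamBar‖ ∂μ ≤ c₁ * (β k / α k) + c₂ * Real.sqrt (α k / N)) ∧
    -- for every fixed `N` the error vanishes: no asymptotic bias
    (∀ (N : ℕ), 1 ≤ N → ∀ (Ω : Type w) [MeasurableSpace Ω] (μ : Measure Ω)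
        [IsProbabilityMeasure μ] (X : ℕ → Fin M → Fin N → Ω → 𝒳)
        (D : ℕ → Fin M → Fin T → Ω → Vec d) (lam : ℕ → Ω → Vec l),
        IsNMTSRun P u α β μ X D lam → MomentBounds P u C₁ C₂ ε R μ D lam →
        Tendsto (fun k => ∫ ω, ‖lam k ω - lamBar‖ ∂μ) atTop (𝓝 0)) ∧
    -- the balanced choice of exponents
    (a = 2 / 3 → b = 1 → ∃ c : ℝ, 0 ≤ c ∧
      ∀ (N : ℕ), 1 ≤ N → ∀ (Ω : Type w) [MeasurableSpace Ω] (μ : Measure Ω)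
        [IsProbabilityMeasure μ] (X : ℕ → Fin M → Fin N → Ω → 𝒳)
        (D : ℕ → Fin M → Fin T → Ω → Vec d) (lam : ℕ → Ω → Vec l),
        IsNMTSRun P u α β μ X D lam → MomentBounds P u C₁ C₂ ε R μ D lam →
        ∀ k : ℕ, 1 ≤ k → ∫ ω, ‖lam k ω - lamBar‖ ∂μ ≤ c * (k : ℝ) ^ (-(1 / 3) : ℝ)) := by
  have hstep : StepSizes a b α₀ β₀ α β :=
    ⟨ha, hab, hb, hα₀, hβ₀, hα_zero, hβ_zero, hα, hβ⟩
  obtain ⟨c, hc, hrate⟩ := exists_rate_const.{u₁, u₂, u₃, w} hstep P u hreg hunb lamBar hint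
    hzero KL hKL hcurv hb_one C₁ C₂ ε R hC₁ hC₂ hR
  refine ⟨⟨c, c, hc, hc, fun N hN Ω _ μ _ X D lam hrun hmom k hk => ?_⟩,
    fun N hN Ω _ μ _ X D lam hrun hmom => ?_, fun ha' hb' =>
    ⟨c * (β₀ / α₀ + √α₀), by positivity, fun N hN Ω _ μ _ X D lam hrun hmom k hk => ?_⟩⟩
  · rw [← mul_add]
    exact hrate N hN Ω μ X D lam hrun hmom k hk
  · have h1 : Tendsto (fun k => c * (β k / α k + √(α k / N))) atTop (𝓝 0) := by
      have h2 := (hstep.tendsto_α.div_const (N : ℝ)).sqrt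
      have h3 := (hstep.tendsto_ratio.add h2).const_mul c
      simpa using h3
    exact squeeze_zero' (Eventually.of_forall fun k => integral_nonneg fun _ => norm_nonneg _)
      ((eventually_ge_atTop 1).mono fun k hk => hrate N hN Ω μ X D lam hrun hmom k hk) h1
  -- For `a = 2/3` and `b = 1` the exponents `b - a` and `a / 2` both equal `1/3`; `N ≥ 1` bounds
  -- `√(α₀ / N)` by `√α₀`.
  · have hk0 : (0 : ℝ) < k := by exact_mod_cast hk
    have e1 : β k / α k = β₀ / α₀ * (k : ℝ) ^ (-(1 / 3) : ℝ) := by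
      rw [hstep.ratio_eq_rpow hk, ha', hb']
      norm_num
    have e2 : √(α k / N) ≤ √α₀ * (k : ℝ) ^ (-(1 / 3) : ℝ) := by
      rw [hstep.sqrt_eq_rpow hk, ha', show -((2 : ℝ) / 3 / 2) = -(1 / 3) by norm_num]
      exact mul_le_mul_of_nonneg_right
        (Real.sqrt_le_sqrt (div_le_self hα₀.le (by exact_mod_cast hN))) (by positivity)
    refine (hrate N hN Ω μ X D lam hrun hmom k hk).trans ?_
    rw [mul_assoc, add_mul, e1]
    gcongr
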